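/- \textbf{Corollary (Cardinality sparsity).} Let $L\ge 1$, let $p_0=d,p_1,\dots,p_L\ge 1$, $p_{L+1}=1$, and for weight matrices $\Theta=(W^L,\dots,W^0)$ with $W^l\in\mathbb R^{p_{l+1}\times p_l}$ consider the network $$g_\Theta[x]=W^L f^L\big[\cdots W^1 f^1[W^0x]\big],\qquad x\in\mathbb R^{d},$$ whose activation functions $f^l:\mathbb R^{p_l}\to\mathbb R^{p_l}$ ($1\le l\le L$) vanish at $0$, are $a_{\mathrm{Lip}}$-Lipschitz ($a_{\mathrm{Lip}}\ge 0$) for the Euclidean norms, and satisfy $f^l[sz]=s f^l[z]$ for all $s\ge 0$. Let $P=\sum_{l=0}^{L}p_{l+1}p_l$ be the number of parameters. Let $A^l$ be the $\binom{p_{l+1}}{2}\times p_{l+1}$ pairwise-difference matrix: it has one row for each pair $i<j$, with entry $1$ in position $i$, $-1$ in position $j$ and $0$ elsewhere. Let $\bar A^l:(\ker A^l)^\perp\to\operatorname{Im}A^l$ be the bijection induced by $A^l$, and set $$M_A=\max_{0\le l\le L}\big\|(\bar A^l)^{-1}\big\|_{1\to1}$$ (the norm is $0$ when $\operatorname{Im}A^l=\{0\}$).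 For $\nu>0$ let $$h[\Theta]=\sum_{l=0}^{L}\|A^lW^l\|_1+\nu\sum_{l=0}^{L}\|\Pi_{A^l}W^l\|_1,\qquad \mathcal A_h=\{\Theta: h[\Theta]\le 1\},$$ where $\|\cdot\|_1$ is the sum of the absolute values of the entries and $\Pi_{A^l}$ projects each column orthogonally onto $\ker A^l$. Consider data $y_i=g[x_i]+u_i$, $i=1,\dots,n$, with an arbitrary function $g:\mathbb R^d\to\mathbb R$, deterministic $x_i\in\mathbb R^d$, and independent centered noise variables $u_i$ with $\max_i K^2\big(\mathbb E e^{|u_i|^2/K^2}-1\big)\le\gamma^2$ for constants $K,\gamma\in(0,\infty)$. Put $$\|x\|_n=\sqrt{\tfrac1n\sum_{i=1}^n\|x_i\|_2^2},\qquad \operatorname{err}(\kappa g_\Omega)=\sqrt{\tfrac1n\sum_{i=1}^n\big(g[x_i]-\kappa g_\Omega[x_i]\big)^2},$$ and let $(\hat\kappa,\hat\Omega)$ denote any minimizer of $\frac1n\sum_{i=1}^n(y_i-\kappa g_\Omega[x_i])^2+\lambda\kappa$ over $\kappa\in[0,\infty)$, $\Omega\in\mathcal A_h$. (i) If all hidden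 widths satisfy $p_1,\dots,p_L\ge m$ for an integer $m\ge1$, then $M_A\le 2/m$; in particular $M_A\ll1$ for wide networks. (ii) There is a constant $C\in(0,\infty)$ that depends only on $K$ and $\gamma$ such that the following holds. For every $r>0$ there is an $n_0$, depending only on $K,\gamma$ and $r$, such that for all $n\ge n_0$ and all $L$, widths, activation functions, inputs, functions $g$ and noise variables as above for which $\rho:=a_{\mathrm{Lip}}^{L}\sqrt L\,(2/L)^L\|x\|_n$ satisfies $\rho=0$ or $\rho\ge r$: if $M_A<1$, $\nu\ge 1/(1-M_A)$ and $$\lambda\ \ge\ C\,a_{\mathrm{Lip}}^{2L}\,\|x\|_n^2\Big(\frac{\sqrt2}{L}\Big)^{2L-1}\sqrt{\log(2P)}\;\frac{\log(2n)}{\sqrt n},$$ then, with probability at least $1-1/n$, every minimizer $(\hat\kappa,\hat\Omega)$ satisfies $$\operatorname{err}^2(\hat\kappa g_{\hat\Omega})\ \le\ \inf_{\kappa\in[0,\infty),\ \Omega\in\mathcal A_h}\big\{\operatorname{err}^2(\kappa g_\Omega)+2\lambda\kappa\big\}.$$ -/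

import Mathlib

open MeasureTheory ProbabilityTheory

noncomputable section

/-- The sum of the absolute values of the entries of a matrix. -/
def matrixL1 {ι κ : Type*} [Fintype ι] [Fintype κ] (B : Matrix ι κ ℝ) : ℝ :=
  ∑ i, ∑ j, |B i j|

/-- The `ℓ₁`-norm of a vector. -/
def vecL1 {ι : Type*} [Fintype ι] (v : EuclideanSpace ℝ ι) : ℝ := ∑ i, |v i|

/-- The linear map `v ↦ G v` between Euclidean spaces. -/
def euclMap {ι κ : Type*} [Fintype ι] [Fintype κ] [DecidableEq κ] (G : Matrix ι κ ℝ) :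
    EuclideanSpace ℝ κ →ₗ[ℝ] EuclideanSpace ℝ ι :=
  Matrix.toLpLin 2 2 G

/-- The inverse `Im G → (ker G)ᗮ` of the bijection `(ker G)ᗮ → Im G` induced by `G`. -/
def inducedInverse {ι κ : Type*} [Fintype ι] [Fintype κ] [DecidableEq κ] (G : Matrix ι κ ℝ) :
    LinearMap.range (euclMap G) ≃ₗ[ℝ] (LinearMap.ker (euclMap G))ᗮ :=
  (LinearMap.kerComplementEquivRange (euclMap G)
    (Submodule.isCompl_orthogonal
      (K := LinearMap.ker (euclMap G))).symm).symm

theorem euclMap_inducedInverse {ι κ : Type*} [Fintype ι] [Fintype κ] [DecidableEq κ]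
    (G : Matrix ι κ ℝ) (y : LinearMap.range (euclMap G)) :
    euclMap G (inducedInverse G y : EuclideanSpace ℝ κ) = y := by
  obtain ⟨v, rfl⟩ := (inducedInverse G).symm.surjective y
  rw [LinearEquiv.apply_symm_apply]
  rfl

/-- The `1 → 1` operator norm of the induced inverse. The vector `y = 0` contributes `0 / 0 = 0`,
so that the norm is `0` if `G = 0`. -/
def inducedInverseNorm {ι κ : Type*} [Fintype ι] [Fintype κ] [DecidableEq κ]
    (G : Matrix ι κ ℝ) : ℝ :=
  ⨆ y : LinearMap.range (euclMap G),
    vecL1 (inducedInverse G y : EuclideanSpace ℝ κ) / vecL1 (y : EuclideanSpace ℝ ι)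

/-- The matrix whose columns are the orthogonal projections of the columns of `W`
onto the kernel of `G`. -/
def kerProjection {ι κ τ : Type*} [Fintype ι] [Fintype κ] [DecidableEq κ]
    (G : Matrix ι κ ℝ) (W : Matrix κ τ ℝ) : Matrix κ τ ℝ :=
  Matrix.of fun i j =>
    (LinearMap.ker (euclMap G)).starProjection (WithLp.toLp 2 fun k => W k j) i

/-- The pairwise-difference matrix with `q` columns: one row for each pair `i < j`, with
entry `1` in column `i`, entry `-1` in column `j`, and zeros elsewhere. -/
def pairDiff (q : ℕ) : Matrix {r : Fin q × Fin q // r.1 < r.2} (Fin q) ℝ :=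
  Matrix.of fun r k => if k = r.1.1 then 1 else if k = r.1.2 then -1 else 0

/-- Layer widths `p₀, …, p_{L+1}` of a network with `L` hidden layers and scalar output
(the values `width l` for `l > L + 1` are not used). -/
structure NetArch (L : ℕ) where
  width : ℕ → ℕ
  width_pos : ∀ l, l ≤ L + 1 → 0 < width l
  width_last : width (L + 1) = 1

namespace NetArch

variable {L : ℕ} (p : NetArch L)

/-- The input space. -/
abbrev Input : Type := EuclideanSpace ℝ (Fin (p.width 0))

/-- Tuples of weight matrices `W⁰, …, W^L`, where `W^l` has size `p_{l+1} × p_l`. -/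
abbrev Params : Type :=
  (l : Fin (L + 1)) → Matrix (Fin (p.width ((l : ℕ) + 1))) (Fin (p.width (l : ℕ))) ℝ

/-- Tuples of activation functions `f¹, …, f^L`; the member with index `l : Fin L` is the
function `f^{l+1}` on `ℝ^{p_{l+1}}`. -/
abbrev Activations : Type :=
  (l : Fin L) → EuclideanSpace ℝ (Fin (p.width ((l : ℕ) + 1))) →
    EuclideanSpace ℝ (Fin (p.width ((l : ℕ) + 1)))

/-- The total number of parameters. -/
def numParams : ℕ := ∑ l : Fin (L + 1), p.width ((l : ℕ) + 1) * p.width (l : ℕ)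

/-- The activations vanish at `0`, are `a`-Lipschitz for the Euclidean norms and are
non-negative homogeneous of degree `1`. -/
structure IsAdmissible (f : p.Activations) (a : ℝ) : Prop where
  map_zero : ∀ l, f l 0 = 0
  lipschitz : ∀ l z z', ‖f l z - f l z'‖ ≤ a * ‖z - z'‖
  homogeneous : ∀ l (s : ℝ) z, 0 ≤ s → f l (s • z) = s • f l z

/-- `W^k f^k[ … W¹ f¹[W⁰ x]]`. -/
def preAct (f : p.Activations) (Θ : p.Params) (x : p.Input) :
    (k : ℕ) → k ≤ L → EuclideanSpace ℝ (Fin (p.width (k + 1)))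
  | 0, _ => euclMap (Θ 0) x
  | k + 1, hk => euclMap (Θ ⟨k + 1, Nat.lt_succ_of_le hk⟩)
      (f ⟨k, hk⟩ (preAct f Θ x k (Nat.le_of_succ_le hk)))

/-- The network `g_Θ[x] = W^L f^L[ … W¹ f¹[W⁰ x]]`. -/
def net (f : p.Activations) (Θ : p.Params) (x : p.Input) : ℝ :=
  p.preAct f Θ x L le_rfl ⟨0, p.width_pos (L + 1) le_rfl⟩

/-- `M_A`, the largest `1 → 1` norm of the induced inverses of the difference matrices. -/
def MA : ℝ := ⨆ l : Fin (L + 1), inducedInverseNorm (pairDiff (p.width ((l : ℕ) + 1)))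

/-- The cardinality-sparsity regularizer `‖A Θ‖₁ + ν ‖Π_A Θ‖₁`. -/
def penalty (ν : ℝ) (Θ : p.Params) : ℝ :=
  ∑ l : Fin (L + 1), matrixL1 (pairDiff (p.width ((l : ℕ) + 1)) * Θ l) +
    ν * ∑ l : Fin (L + 1), matrixL1 (kerProjection (pairDiff (p.width ((l : ℕ) + 1))) (Θ l))

/-- The unit ball of the regularizer. -/
def unitBall (ν : ℝ) : Set p.Params := {Θ | p.penalty ν Θ ≤ 1}

/-- The empirical norm `‖x‖_n` of the inputs. -/
def inputNorm {n : ℕ} (x : Fin n → p.Input) : ℝ := Real.sqrt ((∑ i, ‖x i‖ ^ 2) / n)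

/-- The size `a^L √L (2/L)^L ‖x‖_n` of the network problem. -/
def size (a : ℝ) {n : ℕ} (x : Fin n → p.Input) : ℝ :=
  a ^ L * Real.sqrt (L : ℝ) * (2 / (L : ℝ)) ^ L * p.inputNorm x

/-- The penalized least-squares objective. -/
def objective (f : p.Activations) {n : ℕ} (x : Fin n → p.Input) (y : Fin n → ℝ) (lam : ℝ)
    (κ : ℝ) (Θ : p.Params) : ℝ :=
  1 / (n : ℝ) * ∑ i, (y i - κ * p.net f Θ (x i)) ^ 2 + lam * κ

/-- `(κ, Θ)` minimizes the objective over `[0, ∞) × unitBall`. -/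
def IsEstimator (f : p.Activations) {n : ℕ} (x : Fin n → p.Input) (y : Fin n → ℝ) (lam ν : ℝ)
    (κ : ℝ) (Θ : p.Params) : Prop :=
  0 ≤ κ ∧ Θ ∈ p.unitBall ν ∧
    ∀ κ' : ℝ, 0 ≤ κ' → ∀ Θ' ∈ p.unitBall ν,
      p.objective f x y lam κ Θ ≤ p.objective f x y lam κ' Θ'

/-- The prediction error of `κ g_Θ` for the data-generating function `g`. -/
def predErr (f : p.Activations) {n : ℕ} (x : Fin n → p.Input) (g : p.Input → ℝ)
    (κ : ℝ) (Θ : p.Params) : ℝ :=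
  Real.sqrt (1 / (n : ℝ) * ∑ i, (g (x i) - κ * p.net f Θ (x i)) ^ 2)

end NetArch

/-- Independent, centered noise variables that are uniformly sub-Gaussian with constants
`K` and `γ`: `max_i K² (E exp(|u_i|² / K²) - 1) ≤ γ²`. -/
structure IsSubGaussianNoise {Ω : Type*} [MeasurableSpace Ω] (μ : Measure Ω) {n : ℕ}
    (u : Fin n → Ω → ℝ) (K γ : ℝ) : Prop where
  measurable : ∀ i, Measurable (u i)
  indep : iIndepFun u μ
  centered : ∀ i, ∫ ω, u i ω ∂μ = 0
  integrable_exp : ∀ i, Integrable (fun ω => Real.exp (|u i ω| ^ 2 / K ^ 2)) μ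
  subGaussian : ∀ i, K ^ 2 * (∫ ω, Real.exp (|u i ω| ^ 2 / K ^ 2) ∂μ - 1) ≤ γ ^ 2

end

open scoped BigOperators

/-! The kernel of a pairwise-difference matrix with `q` columns consists of the constant vectors, so
a vector `v` in its orthogonal complement sums to zero. Hence `q |v i| = |∑ j, (v i - v j)|`, and
summing over `i` bounds the induced inverse by `2 / q`. The scalar output layer has no pairs and
contributes `0`. This is (i).

For (ii), expanding the squares in the objective reduces the claim to a deterministic fact
(`predErr_sq_le_iInf`): the oracle inequality holds as soon as `lam` dominates `|2/n ∑ u i * net (x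
i)|` uniformly over the unit ball. Splitting columns along the kernel and its complement puts that
ball inside `∑ l, matrixL1 (Θ l) ≤ 1` (`sum_matrixL1_le_one`). Homogeneity lets each layer be
rescaled to ℓ₁-norm at most `1`; by AM-GM the extracted factor is at most `(L+1)^(-(L+1))`
(`exists_normalized`). On the normalized set networks are bounded, and Lipschitz in the Euclidean
norm of the parameters.

The supremum of the noise process is controlled without chaining. Symmetrization introduces random
signs. A vector-valued contraction principle in exponential form (`expect_exp_iSup_le`), based on a
Khinchine inequality with constant `6`, replaces network values by linear forms in the parameters.
For these, ℓ₁-ℓ∞ duality leaves a maximum over coordinates, which costs only `log P`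
(`expect_exp_iSup_signDot_le`). Markov's inequality then gives the event.

The noise level is of order `√(log (2P) log (2n)) / √n`, whereas the floor on `lam` carries a full
`log (2n)` and, up to constants, one further factor `ρ ≥ r`. The spare `r √(log (2n))` absorbs all
constants for large `n`, so `C = 1` works (`penalty_level_bound`). If `ρ = 0`, the normalized
networks vanish on the data. -/

theorem euclMap_apply {ι κ : Type*} [Fintype ι] [Fintype κ] [DecidableEq κ] (G : Matrix ι κ ℝ)
    (v : EuclideanSpace ℝ κ) (i : ι) : euclMap G v i = ∑ k, G i k * v k := by
  simp [euclMap, Matrix.toLpLin_apply, Matrix.mulVec, dotProduct]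

/-! ### Pairwise-difference matrices and their induced inverses -/

theorem pairDiff_sum_mul (q : ℕ) (v : Fin q → ℝ) (r : {r : Fin q × Fin q // r.1 < r.2}) :
    ∑ k, pairDiff q r k * v k = v r.1.1 - v r.1.2 := by
  have h : ∀ k, pairDiff q r k * v k =
      (if k = r.1.1 then v k else 0) - (if k = r.1.2 then v k else 0) := by
    intro k
    have := r.2.ne
    by_cases h1 : k = r.1.1
    · have h2 : k ≠ r.1.2 := by rw [h1]; exact this
      simp [pairDiff, h1, this]
    · by_cases h2 : k = r.1.2 <;> simp [pairDiff, h1, h2, this.symm]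
  simp [h, Finset.sum_sub_distrib]

theorem euclMap_pairDiff_apply (q : ℕ) (v : EuclideanSpace ℝ (Fin q))
    (r : {r : Fin q × Fin q // r.1 < r.2}) :
    euclMap (pairDiff q) v r = v r.1.1 - v r.1.2 := by
  rw [euclMap_apply, pairDiff_sum_mul q v r]

theorem vecL1_nonneg {ι : Type*} [Fintype ι] (v : EuclideanSpace ℝ ι) : 0 ≤ vecL1 v :=
  Finset.sum_nonneg fun _ _ => abs_nonneg _

theorem vecL1_add_le {ι : Type*} [Fintype ι] (v w : EuclideanSpace ℝ ι) :
    vecL1 (v + w) ≤ vecL1 v + vecL1 w := by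
  unfold vecL1
  rw [← Finset.sum_add_distrib]
  exact Finset.sum_le_sum fun i _ => abs_add_le _ _

theorem matrixL1_nonneg {ι κ : Type*} [Fintype ι] [Fintype κ] (B : Matrix ι κ ℝ) :
    0 ≤ matrixL1 B :=
  Finset.sum_nonneg fun _ _ => Finset.sum_nonneg fun _ _ => abs_nonneg _

theorem sum_abs_sub_eq_two_mul (q : ℕ) (v : Fin q → ℝ) :
    ∑ i, ∑ j, |v i - v j| =
      2 * ∑ r : {r : Fin q × Fin q // r.1 < r.2}, |v r.1.1 - v r.1.2| := by
  have h1 : ∑ r : {r : Fin q × Fin q // r.1 < r.2}, |v r.1.1 - v r.1.2| =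
      ∑ i, ∑ j, if i < j then |v i - v j| else 0 := by
    rw [← Finset.sum_subtype (Finset.univ.filter fun r : Fin q × Fin q => r.1 < r.2) (by simp)
      (fun r => |v r.1 - v r.2|), Finset.sum_filter, Fintype.sum_prod_type]
  have h2 : ∑ i, ∑ j, (if i < j then |v i - v j| else 0) =
      ∑ i, ∑ j, if j < i then |v i - v j| else 0 := by
    rw [Finset.sum_comm]
    simp only [abs_sub_comm]
  rw [two_mul, h1]
  nth_rewrite 2 [h2]
  simp_rw [← Finset.sum_add_distrib]
  refine Finset.sum_congr rfl fun i _ => Finset.sum_congr rfl fun j _ => ?_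
  rcases lt_trichotomy i j with h | h | h
  · simp [h, h.not_gt]
  · simp [h]
  · simp [h, h.not_gt]

/-- Orthogonality to the constants forces zero sum, so every entry is the average of its differences
to all entries. The factor `2` counts each unordered pair twice. -/
theorem vecL1_le_of_mem_orthogonal_ker {q : ℕ} (v : EuclideanSpace ℝ (Fin q))
    (hv : v ∈ (LinearMap.ker (euclMap (pairDiff q)))ᗮ) :
    vecL1 v ≤ 2 / q * vecL1 (euclMap (pairDiff q) v) := by
  rcases Nat.eq_zero_or_pos q with rfl | hq
  · simp [vecL1]
  have hsum : ∑ j, v j = 0 := by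
    have h := hv (WithLp.toLp 2 fun _ => (1 : ℝ)) (by
      rw [LinearMap.mem_ker]
      ext r
      rw [euclMap_pairDiff_apply]
      simp)
    simpa [PiLp.inner_apply] using h
  have h1 : ∀ i, (q : ℝ) * |v i| ≤ ∑ j, |v i - v j| := by
    intro i
    have : ∑ j, (v i - v j) = q * v i := by simp [Finset.sum_sub_distrib, hsum]
    calc (q : ℝ) * |v i| = |∑ j, (v i - v j)| := by rw [this, abs_mul, Nat.abs_cast]
      _ ≤ _ := Finset.abs_sum_le_sum_abs _ _
  have h2 : (q : ℝ) * vecL1 v ≤ 2 * vecL1 (euclMap (pairDiff q) v) := by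
    unfold vecL1
    simp only [euclMap_pairDiff_apply]
    rw [← sum_abs_sub_eq_two_mul q v, Finset.mul_sum]
    exact Finset.sum_le_sum fun i _ => h1 i
  have hq' : (0 : ℝ) < q := by exact_mod_cast hq
  rw [div_mul_eq_mul_div, le_div_iff₀ hq']
  linarith

theorem inducedInverse_pairDiff_ratio_le (q : ℕ) (y : LinearMap.range (euclMap (pairDiff q))) :
    vecL1 (inducedInverse (pairDiff q) y : EuclideanSpace ℝ (Fin q)) /
      vecL1 (y : EuclideanSpace ℝ {r : Fin q × Fin q // r.1 < r.2}) ≤ 2 / q := by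
  have h := vecL1_le_of_mem_orthogonal_ker _ (inducedInverse (pairDiff q) y).2
  rw [euclMap_inducedInverse] at h
  exact div_le_of_le_mul₀ (vecL1_nonneg _) (by positivity) h

theorem inducedInverseNorm_pairDiff_le (q : ℕ) : inducedInverseNorm (pairDiff q) ≤ 2 / q :=
  ciSup_le fun y => inducedInverse_pairDiff_ratio_le q y

theorem inducedInverseNorm_nonneg {ι κ : Type*} [Fintype ι] [Fintype κ] [DecidableEq κ]
    (G : Matrix ι κ ℝ) : 0 ≤ inducedInverseNorm G :=
  Real.iSup_nonneg fun _ => div_nonneg (vecL1_nonneg _) (vecL1_nonneg _)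

/-- The general bound would only give `2` for the scalar output layer; here there are no pairs, so
every ratio is `0 / 0`-type and equals `0`. -/
theorem inducedInverseNorm_pairDiff_one : inducedInverseNorm (pairDiff 1) = 0 := by
  refine le_antisymm (ciSup_le fun y => ?_) (inducedInverseNorm_nonneg _)
  have : vecL1 (y : EuclideanSpace ℝ {r : Fin 1 × Fin 1 // r.1 < r.2}) = 0 := by
    unfold vecL1
    exact Finset.sum_eq_zero fun r _ => absurd r.2 (by simp [Subsingleton.elim r.1.1 r.1.2])
  rw [this, div_zero]

theorem vecL1_le_inducedInverseNorm_mul {q : ℕ} (v : EuclideanSpace ℝ (Fin q))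
    (hv : v ∈ (LinearMap.ker (euclMap (pairDiff q)))ᗮ) :
    vecL1 v ≤ inducedInverseNorm (pairDiff q) * vecL1 (euclMap (pairDiff q) v) := by
  have hy : inducedInverse (pairDiff q) ⟨euclMap (pairDiff q) v, v, rfl⟩ = ⟨v, hv⟩ := by
    rw [inducedInverse, LinearEquiv.symm_apply_eq]
    rfl
  have hle : vecL1 v / vecL1 (euclMap (pairDiff q) v) ≤ inducedInverseNorm (pairDiff q) := by
    have h := le_ciSup (f := fun y : LinearMap.range (euclMap (pairDiff q)) =>
      vecL1 (inducedInverse (pairDiff q) y : EuclideanSpace ℝ (Fin q)) /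
        vecL1 (y : EuclideanSpace ℝ {r : Fin q × Fin q // r.1 < r.2}))
      ⟨2 / q, by rintro _ ⟨y, rfl⟩; exact inducedInverse_pairDiff_ratio_le q y⟩
      ⟨euclMap (pairDiff q) v, v, rfl⟩
    simp only [hy] at h
    exact h
  -- With a vanishing denominator the ratio carries no information; the explicit `2 / q` bound then
  -- forces `v` to vanish.
  rcases (vecL1_nonneg (euclMap (pairDiff q) v)).eq_or_lt with h0 | h0
  · have := vecL1_le_of_mem_orthogonal_ker v hv
    rw [← h0] at this ⊢
    simpa using this
  · exact (div_le_iff₀ h0).1 hle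

theorem matrixL1_eq_sum_vecL1 {ι κ : Type*} [Fintype ι] [Fintype κ] (B : Matrix ι κ ℝ) :
    matrixL1 B = ∑ j, vecL1 (WithLp.toLp 2 fun k => B k j) := by
  unfold matrixL1 vecL1
  rw [Finset.sum_comm]

/-- Each column splits into its projection onto the kernel and an orthogonal remainder with the same
image, to which the induced inverse applies. -/
theorem matrixL1_le_inducedInverseNorm {q : ℕ} {τ : Type*} [Fintype τ]
    (W : Matrix (Fin q) τ ℝ) :
    matrixL1 W ≤ inducedInverseNorm (pairDiff q) * matrixL1 (pairDiff q * W) +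
      matrixL1 (kerProjection (pairDiff q) W) := by
  simp only [matrixL1_eq_sum_vecL1]
  rw [Finset.mul_sum, ← Finset.sum_add_distrib]
  refine Finset.sum_le_sum fun j _ => ?_
  set v : EuclideanSpace ℝ (Fin q) := WithLp.toLp 2 fun k => W k j
  set S := LinearMap.ker (euclMap (pairDiff q))
  have hA : (WithLp.toLp 2 fun k => (pairDiff q * W) k j) = euclMap (pairDiff q) v := by
    ext r
    rw [euclMap_apply]
    simp [Matrix.mul_apply, v]
  have hP : (WithLp.toLp 2 fun k => kerProjection (pairDiff q) W k j) = S.starProjection v := by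
    ext k
    simp [kerProjection, S, v]
  have hker : euclMap (pairDiff q) (S.starProjection v) = 0 :=
    LinearMap.mem_ker.1 (S.starProjection_apply_mem v)
  have h1 := vecL1_le_inducedInverseNorm_mul (v - S.starProjection v)
    (S.sub_starProjection_mem_orthogonal v)
  rw [map_sub, hker, sub_zero] at h1
  rw [hA, hP]
  calc vecL1 v = vecL1 ((v - S.starProjection v) + S.starProjection v) := by simp
    _ ≤ _ := vecL1_add_le _ _
    _ ≤ _ := by gcongr

/-! ### The constant `MA` and the unit ball of the regularizer -/

namespace NetArch

variable {L : ℕ} (p : NetArch L)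

theorem MA_le {m : ℕ} (hm : 0 < m) (h : ∀ l, 1 ≤ l → l ≤ L → m ≤ p.width l) :
    p.MA ≤ 2 / (m : ℝ) := by
  have hm' : (0 : ℝ) < m := by exact_mod_cast hm
  refine ciSup_le fun l => ?_
  rcases (Nat.lt_succ_iff.1 l.2).eq_or_lt with hl | hl
  · rw [hl, p.width_last, inducedInverseNorm_pairDiff_one]
    positivity
  · refine (inducedInverseNorm_pairDiff_le _).trans ?_
    have : (m : ℝ) ≤ p.width ((l : ℕ) + 1) := by exact_mod_cast h _ (by omega) (by omega)
    gcongr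

theorem MA_nonneg : 0 ≤ p.MA := Real.iSup_nonneg fun _ => inducedInverseNorm_nonneg _

/-- The factor `MA < 1` in front of the difference term and `ν ≥ 1` in front of the projection term
make the penalty dominate the plain ℓ₁-norm. -/
theorem sum_matrixL1_le_one {ν : ℝ} (hMA : p.MA < 1) (hν : 1 / (1 - p.MA) ≤ ν) {Θ : p.Params}
    (hΘ : Θ ∈ p.unitBall ν) : ∑ l, matrixL1 (Θ l) ≤ 1 := by
  have hν1 : 1 ≤ ν := by
    refine le_trans ?_ hν
    rw [le_div_iff₀ (by linarith)]
    linarith [p.MA_nonneg]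
  refine le_trans ?_ (show p.penalty ν Θ ≤ 1 from hΘ)
  unfold penalty
  rw [Finset.mul_sum, ← Finset.sum_add_distrib]
  refine Finset.sum_le_sum fun l _ => (matrixL1_le_inducedInverseNorm (Θ l)).trans ?_
  have h1 : inducedInverseNorm (pairDiff (p.width ((l : ℕ) + 1))) ≤ 1 :=
    (le_ciSup (f := fun l : Fin (L + 1) =>
      inducedInverseNorm (pairDiff (p.width ((l : ℕ) + 1)))) (Set.finite_range _).bddAbove l).trans
      hMA.le
  have h2 := matrixL1_nonneg (pairDiff (p.width ((l : ℕ) + 1)) * Θ l)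
  have h3 := matrixL1_nonneg (kerProjection (pairDiff (p.width ((l : ℕ) + 1))) (Θ l))
  nlinarith

end NetArch

/-! ### Random signs and a Khinchine inequality -/

/-- The signed sum `∑ k, ε k * w k`. -/
def signDot {κ : Type*} [Fintype κ] (ε : κ → ℤˣ) (w : κ → ℝ) : ℝ := ∑ k, ((ε k : ℤ) : ℝ) * w k

theorem signDot_neg {κ : Type*} [Fintype κ] (ε : κ → ℤˣ) (w : κ → ℝ) :
    signDot (-ε) w = -signDot ε w := by
  simp [signDot, Finset.sum_neg_distrib]

theorem signDot_sub {κ : Type*} [Fintype κ] (ε : κ → ℤˣ) (v w : κ → ℝ) :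
    signDot ε (fun k => v k - w k) = signDot ε v - signDot ε w := by
  simp [signDot, mul_sub, Finset.sum_sub_distrib]

theorem signDot_smul {κ : Type*} [Fintype κ] (ε : κ → ℤˣ) (c : ℝ) (w : κ → ℝ) :
    signDot ε (fun k => c * w k) = c * signDot ε w := by
  simp only [signDot, Finset.mul_sum]
  exact Finset.sum_congr rfl fun k _ => by ring

theorem abs_sign (e : ℤˣ) : |((e : ℤ) : ℝ)| = 1 := by
  rcases Int.units_eq_one_or e with rfl | rfl <;> simp

theorem abs_signDot_le {κ : Type*} [Fintype κ] (ε : κ → ℤˣ) (w : κ → ℝ) :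
    |signDot ε w| ≤ ∑ k, |w k| := by
  refine (Finset.abs_sum_le_sum_abs _ _).trans (le_of_eq ?_)
  simp only [abs_mul, abs_sign, one_mul]

theorem expect_sign (F : ℤˣ → ℝ) : 𝔼 e, F e = (F 1 + F (-1)) / 2 := by
  rw [Fintype.expect_eq_sum_div_card, UnitsInt.univ]
  simp

theorem expect_pi_prod {κ α : Type*} [Fintype κ] [DecidableEq κ] [Fintype α] (F : κ → α → ℝ) :
    𝔼 ε : κ → α, ∏ k, F k (ε k) = ∏ k, 𝔼 e, F k e := by
  simp only [Fintype.expect_eq_sum_div_card, Finset.prod_div_distrib, Finset.prod_univ_sum,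
    Fintype.piFinset_univ]
  simp

/-- This is the characteristic function of a sum of independent signs: the complex exponential
factorizes, and the real part is taken at the end. -/
theorem expect_cos_signDot {κ : Type*} [Fintype κ] [DecidableEq κ] (w : κ → ℝ) :
    𝔼 ε : κ → ℤˣ, Real.cos (signDot ε w) = ∏ k, Real.cos (w k) := by
  have h : ∑ ε : κ → ℤˣ, ∏ k, Complex.exp ((((ε k : ℤ) : ℝ) * w k : ℝ) * Complex.I) =
      ∏ k, ∑ e : ℤˣ, Complex.exp ((((e : ℤ) : ℝ) * w k : ℝ) * Complex.I) := by
    rw [Finset.prod_univ_sum, Fintype.piFinset_univ]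
  have h1 : ∀ k, ∑ e : ℤˣ, Complex.exp ((((e : ℤ) : ℝ) * w k : ℝ) * Complex.I) =
      ((2 * Real.cos (w k) : ℝ) : ℂ) := by
    intro k
    rw [UnitsInt.univ]
    simp [Complex.two_cos]
  have h2 : ∀ ε : κ → ℤˣ, ∏ k, Complex.exp ((((ε k : ℤ) : ℝ) * w k : ℝ) * Complex.I) =
      Complex.exp ((signDot ε w : ℝ) * Complex.I) := by
    intro ε
    rw [← Complex.exp_sum, ← Finset.sum_mul, signDot]
    push_cast
    rfl
  simp only [h1, h2] at h
  have h3 := congrArg Complex.re h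
  rw [Complex.re_sum, ← Complex.ofReal_prod, Complex.ofReal_re] at h3
  simp only [Complex.exp_ofReal_mul_I_re] at h3
  rw [Fintype.expect_eq_sum_div_card, h3, Finset.prod_mul_distrib]
  simp

theorem one_sub_cos_le_abs (y : ℝ) : 1 - Real.cos y ≤ |y| := by
  rcases le_total |y| 2 with h | h
  · have := Real.one_sub_sq_div_two_le_cos (x := y)
    have h2 : y ^ 2 = |y| * |y| := by rw [← sq, sq_abs]
    nlinarith [abs_nonneg y]
  · linarith [Real.neg_one_le_cos y]

/-- Since `|y| ≥ 1 - cos y`, it suffices to bound the characteristic function at `1` away from `1`.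
For a unit vector, `cos w ≤ exp (-(2/π²) w²)` makes the product at most `exp (-1/5) ≤ 5/6`. -/
theorem one_div_six_le_expect_abs_signDot {κ : Type*} [Fintype κ] [DecidableEq κ] (w : κ → ℝ)
    (hw : ∑ k, w k ^ 2 = 1) : 1 / 6 ≤ 𝔼 ε : κ → ℤˣ, |signDot ε w| := by
  have hle : ∀ k, |w k| ≤ 1 := fun k => by
    rw [← sq_le_one_iff_abs_le_one, ← hw]
    exact Finset.single_le_sum (f := fun k => w k ^ 2) (fun i _ => sq_nonneg _) (Finset.mem_univ k)
  have hcos : ∀ k, Real.cos (w k) ≤ Real.exp (-(2 / Real.pi ^ 2) * w k ^ 2) := fun k => by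
    have h1 := Real.cos_le_one_sub_mul_cos_sq ((hle k).trans (by linarith [Real.pi_gt_three]))
    have h2 := Real.add_one_le_exp (-(2 / Real.pi ^ 2) * w k ^ 2)
    linarith
  have hcos0 : ∀ k, 0 ≤ Real.cos (w k) := fun k => by
    have h1 := abs_le.1 (hle k)
    apply Real.cos_nonneg_of_neg_pi_div_two_le_of_le <;> linarith [Real.pi_gt_three]
  have hprod : ∏ k, Real.cos (w k) ≤ 5 / 6 := by
    calc ∏ k, Real.cos (w k) ≤ ∏ k, Real.exp (-(2 / Real.pi ^ 2) * w k ^ 2) :=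
          Finset.prod_le_prod (fun k _ => hcos0 k) fun k _ => hcos k
      _ = Real.exp (-(2 / Real.pi ^ 2)) := by
          rw [← Real.exp_sum, ← Finset.mul_sum, hw, mul_one]
      _ ≤ Real.exp (-(1 / 5)) := by
          apply Real.exp_le_exp.2
          have hpi : Real.pi ^ 2 ≤ 10 := by nlinarith [Real.pi_lt_d2, Real.pi_pos]
          have : 1 / 5 ≤ 2 / Real.pi ^ 2 := by
            rw [div_le_div_iff₀ (by norm_num) (by positivity)]
            linarith
          linarith
      _ ≤ 5 / 6 := by
          have h5 := Real.add_one_le_exp (1 / 5 : ℝ)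
          rw [Real.exp_neg, inv_le_comm₀ (Real.exp_pos _) (by norm_num)]
          linarith
  calc (1 : ℝ) / 6 ≤ 1 - ∏ k, Real.cos (w k) := by linarith
    _ = 𝔼 ε : κ → ℤˣ, (1 - Real.cos (signDot ε w)) := by
        rw [Finset.expect_sub_distrib, expect_cos_signDot, Fintype.expect_const]
    _ ≤ _ := Finset.expect_le_expect fun ε _ => one_sub_cos_le_abs _

theorem sqrt_sum_sq_le_expect_abs_signDot {κ : Type*} [Fintype κ] [DecidableEq κ] (w : κ → ℝ) :
    Real.sqrt (∑ k, w k ^ 2) ≤ 6 * 𝔼 ε : κ → ℤˣ, |signDot ε w| := by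
  set N := Real.sqrt (∑ k, w k ^ 2) with hN
  rcases (Real.sqrt_nonneg (∑ k, w k ^ 2)).eq_or_lt with h0 | h0
  · rw [hN, ← h0]
    exact mul_nonneg (by norm_num) (Finset.expect_nonneg fun _ _ => abs_nonneg _)
  · rw [← hN] at h0
    have hs : ∑ k, (N⁻¹ * w k) ^ 2 = 1 := by
      simp only [mul_pow]
      rw [← Finset.mul_sum, ← Real.sq_sqrt (Finset.sum_nonneg fun k _ => sq_nonneg (w k)), ← hN,
        ← mul_pow, inv_mul_cancel₀ h0.ne', one_pow]
    have h := one_div_six_le_expect_abs_signDot _ hs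
    simp only [signDot_smul, abs_mul] at h
    rw [← Finset.mul_expect, abs_of_pos (inv_pos.2 h0), inv_mul_eq_div, le_div_iff₀ h0] at h
    linarith

/-- Jensen's inequality, by averaging the tangent line of `exp` at the mean. -/
theorem exp_expect_le {α : Type*} [Fintype α] [Nonempty α] (F : α → ℝ) :
    Real.exp (𝔼 a, F a) ≤ 𝔼 a, Real.exp (F a) := by
  set m := 𝔼 a, F a with hm
  have h : ∀ a, Real.exp m * (1 + (F a - m)) ≤ Real.exp (F a) := fun a => by
    calc Real.exp m * (1 + (F a - m)) ≤ Real.exp m * Real.exp (F a - m) := by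
          gcongr
          linarith [Real.add_one_le_exp (F a - m)]
      _ = Real.exp (F a) := by rw [← Real.exp_add]; ring_nf
  calc Real.exp m = 𝔼 a, Real.exp m * (1 + (F a - m)) := by
        rw [← Finset.mul_expect, Finset.expect_add_distrib, Finset.expect_sub_distrib,
          Fintype.expect_const, Fintype.expect_const, ← hm]
        ring
    _ ≤ _ := Finset.expect_le_expect fun a _ => h a

/-! ### Vector-valued contraction for exponential moments -/

section Contraction

variable {ι κ : Type*} [Fintype κ] [DecidableEq κ]

theorem bddAbove_range_add {ι : Type*} {A B : ι → ℝ} (hA : BddAbove (Set.range A)) {M : ℝ}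
    (hB : ∀ i, B i ≤ M) : BddAbove (Set.range fun i => A i + B i) := by
  obtain ⟨a, ha⟩ := hA
  refine ⟨a + M, ?_⟩
  rintro _ ⟨i, rfl⟩
  exact add_le_add (ha ⟨i, rfl⟩) (hB i)

theorem bddAbove_range_add_signDot {ι κ : Type*} [Fintype κ] {A : ι → ℝ}
    (hA : BddAbove (Set.range A)) {v : ι → κ → ℝ} {V : ℝ} (hv : ∀ t, ∑ k, |v t k| ≤ V)
    (c : ℝ) (ε : κ → ℤˣ) :
    BddAbove (Set.range fun t => A t + c * signDot ε (v t)) :=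
  bddAbove_range_add hA (M := |c| * V) fun t => by
    calc c * signDot ε (v t) ≤ |c * signDot ε (v t)| := le_abs_self _
      _ = |c| * |signDot ε (v t)| := abs_mul _ _
      _ ≤ |c| * V := by gcongr; exact (abs_signDot_le _ _).trans (hv t)

/-- For a pair `s, t`, the Lipschitz bound and Khinchine give `h s - h t ≤ 6 b 𝔼 |signDot ε (v s - v
t)|`. The absolute value is removed by assigning `ε` to one of the two points and `-ε` to the other;
both signs have the same average. -/
theorem iSup_add_iSup_le_expect [Nonempty ι] {A h : ι → ℝ} {v : ι → κ → ℝ} {b V : ℝ}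
    (hA : BddAbove (Set.range A)) (hb : 0 ≤ b)
    (hv : ∀ t, ∑ k, |v t k| ≤ V)
    (hlip : ∀ s t, |h s - h t| ≤ b * Real.sqrt (∑ k, (v s k - v t k) ^ 2)) :
    (⨆ t, (A t + h t)) + (⨆ t, (A t + -h t)) ≤
      2 * 𝔼 ε : κ → ℤˣ, ⨆ t, (A t + 6 * b * signDot ε (v t)) := by
  set R : (κ → ℤˣ) → ℝ := fun ε => ⨆ t, (A t + 6 * b * signDot ε (v t)) with hR
  have hRle : ∀ ε t, A t + 6 * b * signDot ε (v t) ≤ R ε := fun ε t =>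
    le_ciSup (bddAbove_range_add_signDot hA hv (6 * b) ε) t
  have hneg : 𝔼 ε, R (-ε) = 𝔼 ε, R ε :=
    Fintype.expect_equiv (Equiv.neg _) _ _ fun _ => rfl
  have key : ∀ s t, (A s + h s) + (A t + -h t) ≤ 2 * 𝔼 ε, R ε := by
    intro s t
    have h1 : ∀ ε : κ → ℤˣ, A s + A t + 6 * b * |signDot ε fun k => v s k - v t k| ≤
        R ε + R (-ε) := by
      intro ε
      rw [signDot_sub]
      rcases abs_cases (signDot ε (v s) - signDot ε (v t)) with ⟨he, _⟩ | ⟨he, _⟩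
      · have e1 := hRle ε s
        have e2 := hRle (-ε) t
        rw [signDot_neg] at e2
        rw [he]
        linarith
      · have e1 := hRle ε t
        have e2 := hRle (-ε) s
        rw [signDot_neg] at e2
        rw [he]
        linarith
    have h2 := Finset.expect_le_expect (s := Finset.univ) fun ε _ => h1 ε
    simp only [Finset.expect_add_distrib, Fintype.expect_const, hneg, ← Finset.mul_expect] at h2
    have h3 := mul_le_mul_of_nonneg_left
      (sqrt_sum_sq_le_expect_abs_signDot fun k => v s k - v t k) hb
    have h4 := (le_abs_self _).trans (hlip s t)
    linarith
  have hs : ∀ t, (⨆ s, (A s + h s)) ≤ 2 * (𝔼 ε, R ε) - (A t + -h t) := fun t =>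
    ciSup_le fun s => by linarith [key s t]
  have ht : (⨆ t, (A t + -h t)) ≤ 2 * (𝔼 ε, R ε) - ⨆ s, (A s + h s) :=
    ciSup_le fun t => by linarith [hs t]
  linarith

theorem abs_iSup_sub_iSup_le {ι : Type*} [Nonempty ι] {F G : ι → ℝ} {c : ℝ}
    (hF : BddAbove (Set.range F)) (hG : BddAbove (Set.range G)) (h : ∀ i, |F i - G i| ≤ c) :
    |(⨆ i, F i) - ⨆ i, G i| ≤ c := by
  rw [abs_le]
  constructor
  · have : (⨆ i, G i) ≤ (⨆ i, F i) + c :=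
      ciSup_le fun i => by linarith [le_ciSup hF i, (abs_le.1 (h i)).1]
    linarith
  · have : (⨆ i, F i) ≤ (⨆ i, G i) + c :=
      ciSup_le fun i => by linarith [le_ciSup hG i, (abs_le.1 (h i)).2]
    linarith

/-- Only the mean of the two suprema is controlled by contraction. Their half-difference is at most
`H`, and passing from that mean to the mean of exponentials costs `cosh H`. -/
theorem expect_sign_exp_iSup_le [Nonempty ι] {A h : ι → ℝ} {v : ι → κ → ℝ} {H b V : ℝ}
    (hA : BddAbove (Set.range A)) (hb : 0 ≤ b) (hH : ∀ t, |h t| ≤ H)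
    (hv : ∀ t, ∑ k, |v t k| ≤ V)
    (hlip : ∀ s t, |h s - h t| ≤ b * Real.sqrt (∑ k, (v s k - v t k) ^ 2)) :
    𝔼 δ : ℤˣ, Real.exp (⨆ t, (A t + ((δ : ℤ) : ℝ) * h t)) ≤
      Real.cosh H * 𝔼 ε : κ → ℤˣ, Real.exp (⨆ t, (A t + 6 * b * signDot ε (v t))) := by
  rw [expect_sign]
  simp only [Units.val_one, Int.cast_one, one_mul, Units.val_neg, Int.cast_neg, neg_mul]
  set x := ⨆ t, (A t + h t)
  set y := ⨆ t, (A t + -h t)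
  have hxy : |x - y| ≤ 2 * H := by
    refine abs_iSup_sub_iSup_le (bddAbove_range_add hA fun t => (abs_le.1 (hH t)).2)
      (bddAbove_range_add hA (M := H) fun t => by linarith [(abs_le.1 (hH t)).1]) fun t => ?_
    have : A t + h t - (A t + -h t) = 2 * h t := by ring
    rw [this, abs_mul, abs_two]
    linarith [hH t]
  have hH0 : 0 ≤ H := (abs_nonneg _).trans (hH (Classical.arbitrary ι))
  have e : (Real.exp x + Real.exp y) / 2 = Real.cosh ((x - y) / 2) * Real.exp ((x + y) / 2) := by
    rw [Real.cosh_eq, div_mul_eq_mul_div, add_mul, ← Real.exp_add, ← Real.exp_add]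
    ring_nf
  rw [e]
  gcongr
  · rw [Real.cosh_le_cosh, abs_of_nonneg hH0, abs_div, abs_two]
    linarith
  · refine le_trans (Real.exp_le_exp.2 ?_) (exp_expect_le _)
    linarith [iSup_add_iSup_le_expect hA hb hv hlip]

theorem expect_fin_succ {α : Type*} [Fintype α] (n : ℕ) (F : (Fin (n + 1) → α) → ℝ) :
    𝔼 δ, F δ = 𝔼 e : α, 𝔼 δ : Fin n → α, F (Fin.cons e δ) := by
  rw [Fintype.expect_equiv (Fin.consEquiv fun _ => α).symm F
    (fun x : α × (Fin n → α) => F (Fin.cons x.1 x.2)) fun δ => by simp [Fin.consEquiv],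
    ← Finset.univ_product_univ, Finset.expect_product]

/-- Signs are exchanged one at a time. The arbitrary offset `A` makes the induction possible, since
it absorbs the terms not being exchanged. -/
theorem expect_exp_iSup_le [Nonempty ι] {v : ι → κ → ℝ} {V : ℝ} (hv : ∀ t, ∑ k, |v t k| ≤ V) :
    ∀ (n : ℕ) (A : ι → ℝ) (_ : BddAbove (Set.range A)) (h : Fin n → ι → ℝ) (H b : Fin n → ℝ)
      (_ : ∀ i, 0 ≤ b i) (_ : ∀ i t, |h i t| ≤ H i)
      (_ : ∀ i s t, |h i s - h i t| ≤ b i * Real.sqrt (∑ k, (v s k - v t k) ^ 2)),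
      𝔼 δ : Fin n → ℤˣ, Real.exp (⨆ t, (A t + ∑ i, ((δ i : ℤ) : ℝ) * h i t)) ≤
        (∏ i, Real.cosh (H i)) * 𝔼 ε : Fin n → κ → ℤˣ,
          Real.exp (⨆ t, (A t + ∑ i, 6 * b i * signDot (ε i) (v t))) := by
  intro n
  induction n with
  | zero =>
    intro A hA h H b _ _ _
    simp
  | succ n ih =>
    intro A hA h H b hb hH hlip
    rw [expect_fin_succ, expect_fin_succ]
    simp only [Fin.sum_univ_succ, Fin.prod_univ_succ, Fin.cons_zero, Fin.cons_succ]
    calc 𝔼 e : ℤˣ, 𝔼 δ : Fin n → ℤˣ, Real.exp (⨆ t, (A t + (((e : ℤ) : ℝ) * h 0 t +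
          ∑ i : Fin n, ((δ i : ℤ) : ℝ) * h i.succ t)))
        ≤ 𝔼 e : ℤˣ, (∏ i : Fin n, Real.cosh (H i.succ)) * 𝔼 ε : Fin n → κ → ℤˣ,
          Real.exp (⨆ t, (A t + ((e : ℤ) : ℝ) * h 0 t +
            ∑ i : Fin n, 6 * b i.succ * signDot (ε i) (v t))) := by
          refine Finset.expect_le_expect fun e _ => ?_
          simp only [← add_assoc]
          refine ih (fun t => A t + ((e : ℤ) : ℝ) * h 0 t) ?_ (fun i => h i.succ)
            (fun i => H i.succ) (fun i => b i.succ) (fun i => hb _) (fun i => hH _)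
            (fun i => hlip _)
          refine bddAbove_range_add hA (M := H 0) fun t => ?_
          refine (le_abs_self _).trans ?_
          rw [abs_mul, abs_sign, one_mul]
          exact hH 0 t
      _ = (∏ i : Fin n, Real.cosh (H i.succ)) * 𝔼 ε : Fin n → κ → ℤˣ, 𝔼 e : ℤˣ,
          Real.exp (⨆ t, (A t + ∑ i : Fin n, 6 * b i.succ * signDot (ε i) (v t) +
            ((e : ℤ) : ℝ) * h 0 t)) := by
          rw [← Finset.mul_expect, Finset.expect_comm]
          simp only [add_right_comm]
      _ ≤ (∏ i : Fin n, Real.cosh (H i.succ)) * 𝔼 ε : Fin n → κ → ℤˣ,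
          Real.cosh (H 0) * 𝔼 η : κ → ℤˣ,
          Real.exp (⨆ t, (A t + ∑ i : Fin n, 6 * b i.succ * signDot (ε i) (v t) +
            6 * b 0 * signDot η (v t))) := by
          gcongr with ε _
          refine expect_sign_exp_iSup_le ?_ (hb 0) (hH 0) hv (hlip 0)
          refine bddAbove_range_add hA (M := ∑ i : Fin n, |6 * b i.succ| * V) fun t => ?_
          refine Finset.sum_le_sum fun i _ => (le_abs_self _).trans ?_
          rw [abs_mul]
          gcongr
          exact (abs_signDot_le _ _).trans (hv t)
      _ = _ := by
          rw [← Finset.mul_expect, Finset.expect_comm, ← mul_assoc,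
            mul_comm _ (Real.cosh (H 0))]
          congr 1
          refine Finset.expect_congr rfl fun e _ => Finset.expect_congr rfl fun ε _ => ?_
          exact congrArg Real.exp (iSup_congr fun t => by ring)

theorem sum_mul_signDot {κ : Type*} [Fintype κ] {n : ℕ} (ε : Fin n → κ → ℤˣ)
    (b : Fin n → ℝ) (w : κ → ℝ) :
    ∑ i, b i * signDot (ε i) w = ∑ k, w k * ∑ i, b i * ((ε i k : ℤ) : ℝ) := by
  simp only [signDot, Finset.mul_sum]
  rw [Finset.sum_comm]
  exact Finset.sum_congr rfl fun k _ => Finset.sum_congr rfl fun i _ => by ring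

theorem expect_exp_coord (c : ℝ) (k : κ) :
    𝔼 η : κ → ℤˣ, Real.exp (c * ((η k : ℤ) : ℝ)) = Real.cosh c := by
  have h1 : 𝔼 η : κ → ℤˣ, Real.exp (c * ((η k : ℤ) : ℝ)) =
      𝔼 η : κ → ℤˣ, Real.exp (-(c * ((η k : ℤ) : ℝ))) :=
    Fintype.expect_equiv (Equiv.neg _) _ _ fun η => by simp
  have h2 : ∀ η : κ → ℤˣ, Real.exp (c * ((η k : ℤ) : ℝ)) + Real.exp (-(c * ((η k : ℤ) : ℝ))) =
      2 * Real.cosh c := by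
    intro η
    rw [Real.cosh_eq]
    rcases Int.units_eq_one_or (η k) with h | h <;> simp [h] <;> ring
  have h3 : 𝔼 η : κ → ℤˣ, (Real.exp (c * ((η k : ℤ) : ℝ)) +
      Real.exp (-(c * ((η k : ℤ) : ℝ)))) = 2 * Real.cosh c := by
    simp only [h2, Fintype.expect_const]
  rw [Finset.expect_add_distrib, ← h1] at h3
  linarith

theorem exp_mul_abs_le (V y : ℝ) : Real.exp (V * |y|) ≤ Real.exp (V * y) + Real.exp (-V * y) := by
  rcases abs_cases y with ⟨h, _⟩ | ⟨h, _⟩ <;> rw [h]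
  · linarith [Real.exp_pos (-V * y)]
  · rw [mul_neg, ← neg_mul]
    linarith [Real.exp_pos (V * y)]

/-- By ℓ₁-ℓ∞ duality the supremum is at most `V` times the largest coordinate sum in modulus. The
exponential of a maximum is bounded by the sum over coordinates and both signs, whence `2 * card κ`;
independence factors each term. -/
theorem expect_exp_iSup_signDot_le [Nonempty ι] [Nonempty κ] {v : ι → κ → ℝ} {V : ℝ}
    (hv : ∀ t, ∑ k, |v t k| ≤ V) {n : ℕ} (b : Fin n → ℝ) :
    𝔼 ε : Fin n → κ → ℤˣ, Real.exp (⨆ t, ∑ i, b i * signDot (ε i) (v t)) ≤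
      2 * Fintype.card κ * ∏ i, Real.cosh (V * b i) := by
  have hpt : ∀ ε : Fin n → κ → ℤˣ, Real.exp (⨆ t, ∑ i, b i * signDot (ε i) (v t)) ≤
      ∑ k, (Real.exp (V * ∑ i, b i * ((ε i k : ℤ) : ℝ)) +
        Real.exp (-V * ∑ i, b i * ((ε i k : ℤ) : ℝ))) := by
    intro ε
    set Y : κ → ℝ := fun k => ∑ i, b i * ((ε i k : ℤ) : ℝ) with hY
    obtain ⟨k₀, hk₀⟩ := Finite.exists_max fun k => |Y k|
    have h1 : (⨆ t, ∑ i, b i * signDot (ε i) (v t)) ≤ V * |Y k₀| := by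
      refine ciSup_le fun t => ?_
      rw [sum_mul_signDot]
      calc ∑ k, v t k * Y k ≤ ∑ k, |v t k| * |Y k₀| :=
            Finset.sum_le_sum fun k _ => by
              refine (le_abs_self _).trans ?_
              rw [abs_mul]
              exact mul_le_mul_of_nonneg_left (hk₀ k) (abs_nonneg _)
        _ = (∑ k, |v t k|) * |Y k₀| := by rw [Finset.sum_mul]
        _ ≤ V * |Y k₀| := by gcongr; exact hv t
    refine (Real.exp_le_exp.2 h1).trans ((exp_mul_abs_le _ _).trans ?_)
    exact Finset.single_le_sum (f := fun k => Real.exp (V * Y k) + Real.exp (-V * Y k))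
      (fun k _ => by positivity) (Finset.mem_univ k₀)
  have hcoord : ∀ (c : ℝ) (k : κ), 𝔼 ε : Fin n → κ → ℤˣ,
      Real.exp (c * ∑ i, b i * ((ε i k : ℤ) : ℝ)) = ∏ i, Real.cosh (c * b i) := by
    intro c k
    simp only [Finset.mul_sum, Real.exp_sum]
    rw [expect_pi_prod fun i (η : κ → ℤˣ) => Real.exp (c * (b i * ((η k : ℤ) : ℝ)))]
    refine Finset.prod_congr rfl fun i _ => ?_
    simp only [← mul_assoc]
    exact expect_exp_coord _ k
  refine (Finset.expect_le_expect fun ε _ => hpt ε).trans (le_of_eq ?_)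
  rw [Finset.expect_sum_comm]
  simp only [Finset.expect_add_distrib, hcoord]
  simp only [neg_mul, Real.cosh_neg]
  rw [Finset.sum_const, Finset.card_univ, nsmul_eq_mul]
  ring

theorem expect_exp_iSup_sign_le [Nonempty ι] [Nonempty κ] {v : ι → κ → ℝ} {V : ℝ}
    (hv : ∀ t, ∑ k, |v t k| ≤ V) {n : ℕ} (h : Fin n → ι → ℝ) (H b : Fin n → ℝ)
    (hb : ∀ i, 0 ≤ b i) (hH : ∀ i t, |h i t| ≤ H i)
    (hlip : ∀ i s t, |h i s - h i t| ≤ b i * Real.sqrt (∑ k, (v s k - v t k) ^ 2)) :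
    𝔼 δ : Fin n → ℤˣ, Real.exp (⨆ t, ∑ i, ((δ i : ℤ) : ℝ) * h i t) ≤
      2 * Fintype.card κ * ∏ i, Real.cosh (H i + V * (6 * b i)) := by
  have h1 := expect_exp_iSup_le hv n (fun _ => 0) (by simp) h H b hb hH hlip
  simp only [zero_add] at h1
  have hV : 0 ≤ V := (Finset.sum_nonneg fun k _ => abs_nonneg _).trans (hv (Classical.arbitrary ι))
  -- The two families of hyperbolic cosines merge because `cosh x * cosh y ≤ cosh (x + y)` for
  -- nonnegative `x, y`.
  have h2 : (∏ i, Real.cosh (H i)) * ∏ i, Real.cosh (V * (6 * b i)) ≤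
      ∏ i, Real.cosh (H i + V * (6 * b i)) := by
    rw [← Finset.prod_mul_distrib]
    refine Finset.prod_le_prod (fun i _ => by positivity) fun i _ => ?_
    have hH0 : 0 ≤ H i := (abs_nonneg _).trans (hH i (Classical.arbitrary ι))
    rw [Real.cosh_add]
    have := mul_nonneg (Real.sinh_nonneg_iff.2 hH0)
      (Real.sinh_nonneg_iff.2 (mul_nonneg hV (mul_nonneg (by norm_num : (0 : ℝ) ≤ 6) (hb i))))
    linarith
  refine h1.trans ?_
  calc _ ≤ (∏ i, Real.cosh (H i)) * (2 * Fintype.card κ * ∏ i, Real.cosh (V * (6 * b i))) := by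
        gcongr
        exact expect_exp_iSup_signDot_le hv _
    _ = 2 * Fintype.card κ * ((∏ i, Real.cosh (H i)) * ∏ i, Real.cosh (V * (6 * b i))) := by ring
    _ ≤ _ := by gcongr

end Contraction

/-! ### Sub-Gaussian laws and their symmetrization -/

/-- A centered probability law on `ℝ` that is sub-Gaussian with constants `K` and `γ`. -/
structure IsSubGaussianLaw (ν : Measure ℝ) (K γ : ℝ) : Prop where
  centered : ∫ x, x ∂ν = 0
  integrable_exp : Integrable (fun x => Real.exp (|x| ^ 2 / K ^ 2)) ν
  subGaussian : K ^ 2 * (∫ x, Real.exp (|x| ^ 2 / K ^ 2) ∂ν - 1) ≤ γ ^ 2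

/-- The law of the difference of two independent copies. -/
noncomputable def symmetrizedLaw (ν : Measure ℝ) : Measure ℝ :=
  (ν.prod ν).map fun z => z.1 - z.2

instance (ν : Measure ℝ) [IsProbabilityMeasure ν] : IsProbabilityMeasure (symmetrizedLaw ν) :=
  Measure.isProbabilityMeasure_map (measurable_fst.sub measurable_snd).aemeasurable

theorem symmetrizedLaw_map_sign (ν : Measure ℝ) [IsProbabilityMeasure ν] (e : ℤˣ) :
    (symmetrizedLaw ν).map (fun x => ((e : ℤ) : ℝ) * x) = symmetrizedLaw ν := by
  rcases Int.units_eq_one_or e with rfl | rfl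
  · simp
  · have hm : Measurable fun z : ℝ × ℝ => z.1 - z.2 := measurable_fst.sub measurable_snd
    rw [symmetrizedLaw, Measure.map_map (by fun_prop) hm]
    nth_rewrite 2 [← Measure.prod_swap]
    rw [Measure.map_map hm measurable_swap]
    congr 1
    ext z
    simp

namespace IsSubGaussianLaw

variable {ν : Measure ℝ} [IsProbabilityMeasure ν] {K γ : ℝ}

theorem integrable_id {ν : Measure ℝ} {K γ : ℝ} (h : IsSubGaussianLaw ν K γ) (hK : 0 < K) :
    Integrable (fun x => x) ν := by
  refine Integrable.mono' (h.integrable_exp.const_mul K) aestronglyMeasurable_id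
    (Filter.Eventually.of_forall fun x => ?_)
  rw [Real.norm_eq_abs]
  have h1 : |x| / K ≤ |x| ^ 2 / K ^ 2 + 1 := by
    rw [← div_pow]
    nlinarith [sq_nonneg (|x| / K - 1), sq_nonneg (|x| / K)]
  have h2 := h1.trans (Real.add_one_le_exp _)
  rwa [div_le_iff₀ hK, mul_comm] at h2

/-- Convexity gives `exp (θ z) ≤ 1 + θ (exp z - 1)` for `θ ∈ [0, 1]`, so the hypothesis at `θ = 1`
interpolates linearly, and `1 + y ≤ exp y` closes the bound. -/
theorem lintegral_exp_sq_le (h : IsSubGaussianLaw ν K γ) (hK : 0 < K) {θ : ℝ} (h0 : 0 ≤ θ)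
    (h1 : θ ≤ 1) :
    ∫⁻ x, ENNReal.ofReal (Real.exp (θ * (x ^ 2 / K ^ 2))) ∂ν ≤
      ENNReal.ofReal (Real.exp (θ * (γ ^ 2 / K ^ 2))) := by
  have hle : ∀ x : ℝ, Real.exp (θ * (x ^ 2 / K ^ 2)) ≤
      1 + θ * (Real.exp (|x| ^ 2 / K ^ 2) - 1) := by
    intro x
    rw [sq_abs]
    have := convexOn_exp.2 (Set.mem_univ (0 : ℝ)) (Set.mem_univ (x ^ 2 / K ^ 2))
      (by linarith : 0 ≤ 1 - θ) h0 (by ring)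
    simp only [smul_eq_mul, mul_zero, zero_add, Real.exp_zero, mul_one] at this
    linarith
  have hint0 : Integrable (fun x => θ * (Real.exp (|x| ^ 2 / K ^ 2) - 1)) ν :=
    (h.integrable_exp.sub (integrable_const 1)).const_mul θ
  have hint : Integrable (fun x => 1 + θ * (Real.exp (|x| ^ 2 / K ^ 2) - 1)) ν :=
    (integrable_const 1).add hint0
  calc ∫⁻ x, ENNReal.ofReal (Real.exp (θ * (x ^ 2 / K ^ 2))) ∂ν
      ≤ ∫⁻ x, ENNReal.ofReal (1 + θ * (Real.exp (|x| ^ 2 / K ^ 2) - 1)) ∂ν :=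
        lintegral_mono fun x => ENNReal.ofReal_le_ofReal (hle x)
    _ = ENNReal.ofReal (∫ x, (1 + θ * (Real.exp (|x| ^ 2 / K ^ 2) - 1)) ∂ν) :=
        (ofReal_integral_eq_lintegral_ofReal hint (Filter.Eventually.of_forall fun x =>
          (Real.exp_pos _).le.trans (hle x))).symm
    _ ≤ _ := by
        apply ENNReal.ofReal_le_ofReal
        rw [integral_add (integrable_const 1) hint0, integral_const_mul,
          integral_sub h.integrable_exp (integrable_const 1)]
        simp only [integral_const, probReal_univ, smul_eq_mul, mul_one]
        have h2 : ∫ x, Real.exp (|x| ^ 2 / K ^ 2) ∂ν - 1 ≤ γ ^ 2 / K ^ 2 := by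
          rw [le_div_iff₀ (by positivity), mul_comm]
          exact h.subGaussian
        have h3 := mul_le_mul_of_nonneg_left h2 h0
        linarith [Real.add_one_le_exp (θ * (γ ^ 2 / K ^ 2))]

theorem lintegral_cosh_le (h : IsSubGaussianLaw ν K γ) (hK : 0 < K) (l : ℝ) :
    ∫⁻ x, ENNReal.ofReal (Real.cosh (l * x)) ∂symmetrizedLaw ν ≤
      ENNReal.ofReal (Real.exp ((K ^ 2 / 2 + 2 * γ ^ 2) * l ^ 2)) := by
  have key : ∀ θ c : ℝ, 0 ≤ θ → θ ≤ 1 →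
      (∀ x y : ℝ, Real.cosh (l * (x - y)) ≤
        Real.exp c * (Real.exp (θ * (x ^ 2 / K ^ 2)) * Real.exp (θ * (y ^ 2 / K ^ 2)))) →
      c + 2 * (θ * (γ ^ 2 / K ^ 2)) ≤ (K ^ 2 / 2 + 2 * γ ^ 2) * l ^ 2 →
      ∫⁻ x, ENNReal.ofReal (Real.cosh (l * x)) ∂symmetrizedLaw ν ≤
        ENNReal.ofReal (Real.exp ((K ^ 2 / 2 + 2 * γ ^ 2) * l ^ 2)) := by
    intro θ c h0 h1 hle hc
    have hm : Measurable fun x : ℝ => ENNReal.ofReal (Real.exp (θ * (x ^ 2 / K ^ 2))) := by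
      fun_prop
    have hcm : Measurable fun x : ℝ => ENNReal.ofReal (Real.cosh (l * x)) :=
      (Real.measurable_cosh.comp (measurable_const_mul l)).ennreal_ofReal
    have hdm : Measurable fun z : ℝ × ℝ => z.1 - z.2 := measurable_fst.sub measurable_snd
    rw [symmetrizedLaw, lintegral_map hcm hdm]
    calc ∫⁻ z : ℝ × ℝ, ENNReal.ofReal (Real.cosh (l * (z.1 - z.2))) ∂ν.prod ν
        ≤ ∫⁻ z : ℝ × ℝ, ENNReal.ofReal (Real.exp c) *
          (ENNReal.ofReal (Real.exp (θ * (z.1 ^ 2 / K ^ 2))) *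
            ENNReal.ofReal (Real.exp (θ * (z.2 ^ 2 / K ^ 2)))) ∂ν.prod ν := by
          refine lintegral_mono fun z => ?_
          rw [← ENNReal.ofReal_mul (Real.exp_pos _).le, ← ENNReal.ofReal_mul (Real.exp_pos _).le]
          exact ENNReal.ofReal_le_ofReal (hle z.1 z.2)
      _ = ENNReal.ofReal (Real.exp c) *
          ((∫⁻ x, ENNReal.ofReal (Real.exp (θ * (x ^ 2 / K ^ 2))) ∂ν) *
            ∫⁻ x, ENNReal.ofReal (Real.exp (θ * (x ^ 2 / K ^ 2))) ∂ν) := by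
          rw [lintegral_const_mul' _ _ ENNReal.ofReal_ne_top,
            lintegral_prod_mul hm.aemeasurable hm.aemeasurable]
      _ ≤ ENNReal.ofReal (Real.exp c) * (ENNReal.ofReal (Real.exp (θ * (γ ^ 2 / K ^ 2))) *
          ENNReal.ofReal (Real.exp (θ * (γ ^ 2 / K ^ 2)))) := by
          gcongr <;> exact h.lintegral_exp_sq_le hK h0 h1
      _ ≤ _ := by
          rw [← ENNReal.ofReal_mul (Real.exp_pos _).le, ← ENNReal.ofReal_mul (Real.exp_pos _).le,
            ← Real.exp_add, ← Real.exp_add]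
          apply ENNReal.ofReal_le_ofReal
          apply Real.exp_le_exp.2
          linarith
  have hK2 : 0 < K ^ 2 := by positivity
  have hsq : ∀ x y : ℝ, (x - y) ^ 2 / 2 ≤ x ^ 2 + y ^ 2 := fun x y => by
    nlinarith [sq_nonneg (x + y)]
  -- For small `l`, `cosh y ≤ exp (y²/2)` is integrable with `θ = l² K²`. For large `l` this would
  -- need `θ > 1`; instead `|l (x - y)|` is split by Young's inequality with `θ = 1`, which produces
  -- the `K² / 2` in the constant.
  rcases le_total (l ^ 2 * K ^ 2) 1 with h1 | h1
  · refine key (l ^ 2 * K ^ 2) 0 (by positivity) h1 (fun x y => ?_) ?_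
    · rw [Real.exp_zero, one_mul, ← Real.exp_add]
      refine (Real.cosh_le_exp_half_sq _).trans (Real.exp_le_exp.2 ?_)
      have e : l ^ 2 * K ^ 2 * (x ^ 2 / K ^ 2) + l ^ 2 * K ^ 2 * (y ^ 2 / K ^ 2) =
          l ^ 2 * (x ^ 2 + y ^ 2) := by
        field_simp
      rw [e]
      nlinarith [mul_le_mul_of_nonneg_left (hsq x y) (sq_nonneg l)]
    · have e : l ^ 2 * K ^ 2 * (γ ^ 2 / K ^ 2) = l ^ 2 * γ ^ 2 := by field_simp
      rw [e]
      nlinarith [mul_nonneg hK2.le (sq_nonneg l)]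
  · refine key 1 (l ^ 2 * K ^ 2 / 2) zero_le_one le_rfl (fun x y => ?_) ?_
    · rw [one_mul, one_mul, ← Real.exp_add, ← Real.exp_add, Real.cosh_eq]
      have hb : |l * (x - y)| ≤ l ^ 2 * K ^ 2 / 2 + (x ^ 2 / K ^ 2 + y ^ 2 / K ^ 2) := by
        have e1 : |l * (x - y)| = (|l| * K) * (|x - y| / K) := by
          rw [abs_mul]; field_simp
        have e2 : (|x - y| / K) ^ 2 / 2 ≤ x ^ 2 / K ^ 2 + y ^ 2 / K ^ 2 := by
          rw [div_pow, sq_abs, ← add_div, div_div, mul_comm (K ^ 2) 2, ← div_div]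
          gcongr
          exact hsq x y
        have e3 : (|l| * K) ^ 2 = l ^ 2 * K ^ 2 := by rw [mul_pow, sq_abs]
        nlinarith [sq_nonneg (|l| * K - |x - y| / K)]
      have h3 := Real.exp_le_exp.2 ((le_abs_self _).trans hb)
      have h4 := Real.exp_le_exp.2 ((neg_le_abs _).trans hb)
      linarith
    · have e : γ ^ 2 / K ^ 2 ≤ γ ^ 2 * l ^ 2 := by
        rw [div_le_iff₀ hK2]
        nlinarith [mul_le_mul_of_nonneg_left h1 (sq_nonneg γ)]
      nlinarith

end IsSubGaussianLaw

/-! ### Exponential moments and tails of the noise process -/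

section SignedSums

variable {ι : Type*} [Nonempty ι] {n : ℕ}

theorem sum_mul_le_sum_abs_mul {ι : Type*} {n : ℕ} {h : Fin n → ι → ℝ} {H : Fin n → ℝ}
    (hH : ∀ i t, |h i t| ≤ H i) (w : Fin n → ℝ) (t : ι) :
    |∑ i, w i * h i t| ≤ ∑ i, |w i| * H i := by
  refine (Finset.abs_sum_le_sum_abs _ _).trans (Finset.sum_le_sum fun i _ => ?_)
  rw [abs_mul]
  exact mul_le_mul_of_nonneg_left (hH i t) (abs_nonneg _)

theorem bddAbove_range_sum_mul {ι : Type*} {n : ℕ} {h : Fin n → ι → ℝ} {H : Fin n → ℝ}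
    (hH : ∀ i t, |h i t| ≤ H i) (w : Fin n → ℝ) : BddAbove (Set.range fun t => ∑ i, w i * h i t) :=
  ⟨∑ i, |w i| * H i, by
    rintro _ ⟨t, rfl⟩
    exact (le_abs_self _).trans (sum_mul_le_sum_abs_mul hH w t)⟩

theorem continuous_iSup_sum_mul {h : Fin n → ι → ℝ} {H : Fin n → ℝ} (hH : ∀ i t, |h i t| ≤ H i) :
    Continuous fun w : Fin n → ℝ => ⨆ t, ∑ i, w i * h i t := by
  rw [continuous_iff_continuousAt]
  intro w₀
  rw [ContinuousAt, tendsto_iff_dist_tendsto_zero]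
  have hlim : Filter.Tendsto (fun w : Fin n → ℝ => ∑ i, |w i - w₀ i| * H i) (nhds w₀)
      (nhds 0) := by
    have hc : Continuous fun w : Fin n → ℝ => ∑ i, |w i - w₀ i| * H i := by fun_prop
    have := hc.tendsto w₀
    simpa using this
  refine squeeze_zero (fun _ => dist_nonneg) (fun w => ?_) hlim
  rw [Real.dist_eq]
  refine abs_iSup_sub_iSup_le (bddAbove_range_sum_mul hH w) (bddAbove_range_sum_mul hH w₀)
    fun t => ?_
  have := sum_mul_le_sum_abs_mul hH (fun i => w i - w₀ i) t
  simpa only [sub_mul, Finset.sum_sub_distrib] using this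

theorem one_le_lintegral_exp {α : Type*} [MeasurableSpace α] {μ : Measure α}
    [IsProbabilityMeasure μ] {Y : α → ℝ} (hY : Integrable Y μ) (h0 : ∫ a, Y a ∂μ = 0) :
    1 ≤ ∫⁻ a, ENNReal.ofReal (Real.exp (Y a)) ∂μ := by
  by_cases htop : ∫⁻ a, ENNReal.ofReal (Real.exp (Y a)) ∂μ = ⊤
  · rw [htop]; exact le_top
  have hint : Integrable (fun a => Real.exp (Y a)) μ := by
    refine ⟨(Real.continuous_exp.comp_aestronglyMeasurable hY.1), ?_⟩
    rw [hasFiniteIntegral_iff_ofReal (Filter.Eventually.of_forall fun _ => (Real.exp_pos _).le)]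
    exact lt_top_iff_ne_top.2 htop
  rw [← ofReal_integral_eq_lintegral_ofReal hint
    (Filter.Eventually.of_forall fun _ => (Real.exp_pos _).le), ENNReal.one_le_ofReal]
  calc (1 : ℝ) = ∫ a, (Y a + 1) ∂μ := by
        rw [integral_add hY (integrable_const 1), h0]
        simp
    _ ≤ _ := integral_mono (hY.add (integrable_const 1)) hint fun a => Real.add_one_le_exp _

/-- Subtracting an independent centered copy can only increase the exponential moment, by Jensen's
inequality. It is applied to each `t` separately, before taking the supremum. -/
theorem lintegral_exp_iSup_le_symmetrized {ν : Fin n → Measure ℝ} [∀ i, IsProbabilityMeasure (ν i)]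
    (hint : ∀ i, Integrable (fun x => x) (ν i)) (hcent : ∀ i, ∫ x, x ∂ν i = 0)
    {h : Fin n → ι → ℝ} {H : Fin n → ℝ} (hH : ∀ i t, |h i t| ≤ H i) :
    ∫⁻ w, ENNReal.ofReal (Real.exp (⨆ t, ∑ i, w i * h i t)) ∂Measure.pi ν ≤
      ∫⁻ w, ENNReal.ofReal (Real.exp (⨆ t, ∑ i, w i * h i t)) ∂Measure.pi
        fun i => symmetrizedLaw (ν i) := by
  set Z : (Fin n → ℝ) → ℝ := fun w => ⨆ t, ∑ i, w i * h i t with hZ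
  have hZm : Measurable fun w => ENNReal.ofReal (Real.exp (Z w)) :=
    (Real.measurable_exp.comp (continuous_iSup_sum_mul hH).measurable).ennreal_ofReal
  have hev : ∀ i, Integrable (fun w : Fin n → ℝ => w i) (Measure.pi ν) := fun i =>
    integrable_comp_eval (X := fun _ => ℝ) (f := fun x : ℝ => x) (hint i)
  have hpt : ∀ w, ENNReal.ofReal (Real.exp (Z w)) ≤
      ∫⁻ w', ENNReal.ofReal (Real.exp (Z (w - w'))) ∂Measure.pi ν := by
    intro w
    set I := ∫⁻ w', ENNReal.ofReal (Real.exp (Z (w - w'))) ∂Measure.pi ν with hI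
    have ht : ∀ t, ENNReal.ofReal (Real.exp (∑ i, w i * h i t)) ≤ I := by
      intro t
      have hY : Integrable (fun w' : Fin n → ℝ => -∑ i, w' i * h i t) (Measure.pi ν) :=
        (integrable_finsetSum _ fun i _ =>
          (hev i).mul_const _).neg
      have h0 : ∫ w' : Fin n → ℝ, -∑ i, w' i * h i t ∂Measure.pi ν = 0 := by
        rw [integral_neg, integral_finsetSum _ fun i _ =>
          (hev i).mul_const _, neg_eq_zero]
        refine Finset.sum_eq_zero fun i _ => ?_
        rw [integral_mul_const, integral_comp_eval (X := fun _ => ℝ) (f := fun x : ℝ => x)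
          aestronglyMeasurable_id,
          hcent i, zero_mul]
      calc ENNReal.ofReal (Real.exp (∑ i, w i * h i t))
          ≤ ENNReal.ofReal (Real.exp (∑ i, w i * h i t)) *
            ∫⁻ w', ENNReal.ofReal (Real.exp (-∑ i, w' i * h i t)) ∂Measure.pi ν :=
            le_mul_of_one_le_right (by positivity) (one_le_lintegral_exp hY h0)
        _ = ∫⁻ w', ENNReal.ofReal (Real.exp (∑ i, w i * h i t)) *
            ENNReal.ofReal (Real.exp (-∑ i, w' i * h i t)) ∂Measure.pi ν := by
            rw [lintegral_const_mul]
            fun_prop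
        _ ≤ I := by
            refine lintegral_mono fun w' => ?_
            rw [← ENNReal.ofReal_mul (Real.exp_pos _).le, ← Real.exp_add]
            refine ENNReal.ofReal_le_ofReal (Real.exp_le_exp.2 ?_)
            have := le_ciSup (bddAbove_range_sum_mul hH (w - w')) t
            refine (le_of_eq ?_).trans this
            simp only [Pi.sub_apply, sub_mul, Finset.sum_sub_distrib]
            ring
    -- A finite `I` bounds every index uniformly, so taking logarithms passes the bound to the
    -- supremum.
    by_cases htop : I = ⊤
    · rw [htop]; exact le_top
    have hr : ∀ t, Real.exp (∑ i, w i * h i t) ≤ I.toReal := fun t =>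
      (ENNReal.ofReal_le_iff_le_toReal htop).1 (ht t)
    have hpos : 0 < I.toReal := (Real.exp_pos _).trans_le (hr (Classical.arbitrary ι))
    rw [ENNReal.ofReal_le_iff_le_toReal htop, ← Real.le_log_iff_exp_le hpos]
    exact ciSup_le fun t => (Real.le_log_iff_exp_le hpos).2 (hr t)
  have hsub : Measurable fun z : (Fin n → ℝ) × (Fin n → ℝ) => z.1 - z.2 :=
    measurable_fst.sub measurable_snd
  have hmp := measurePreserving_arrowProdEquivProdArrow ℝ ℝ (Fin n) ν ν
  have hmap : (Measure.pi fun i => symmetrizedLaw (ν i)) =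
      ((Measure.pi ν).prod (Measure.pi ν)).map fun z => z.1 - z.2 := by
    rw [← hmp.map_eq, Measure.map_map hsub hmp.measurable]
    have hs : ∀ i, IsProbabilityMeasure
        (((ν i).prod (ν i)).map fun z : ℝ × ℝ => z.1 - z.2) := fun i =>
      inferInstanceAs (IsProbabilityMeasure (symmetrizedLaw (ν i)))
    exact (Measure.pi_map_pi (μ := fun i => (ν i).prod (ν i))
      (f := fun _ (z : ℝ × ℝ) => z.1 - z.2)
      fun i => (measurable_fst.sub measurable_snd).aemeasurable).symm
  have hZs : Measurable fun z : (Fin n → ℝ) × (Fin n → ℝ) =>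
      ENNReal.ofReal (Real.exp (Z (z.1 - z.2))) := hZm.comp hsub
  rw [hmap, lintegral_map hZm hsub, lintegral_prod _ hZs.aemeasurable]
  exact lintegral_mono hpt

theorem lintegral_sign_mul {ν : Fin n → Measure ℝ} [∀ i, IsProbabilityMeasure (ν i)]
    {F : (Fin n → ℝ) → ENNReal} (hF : Measurable F) (δ : Fin n → ℤˣ) :
    ∫⁻ w, F (fun i => ((δ i : ℤ) : ℝ) * w i) ∂Measure.pi (fun i => symmetrizedLaw (ν i)) =
      ∫⁻ w, F w ∂Measure.pi fun i => symmetrizedLaw (ν i) := by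
  have hs : ∀ i, SigmaFinite ((symmetrizedLaw (ν i)).map fun x => ((δ i : ℤ) : ℝ) * x) := by
    intro i
    rw [symmetrizedLaw_map_sign]
    infer_instance
  have h := Measure.pi_map_pi (μ := fun i => symmetrizedLaw (ν i))
    (f := fun i (x : ℝ) => ((δ i : ℤ) : ℝ) * x) fun i => (measurable_const_mul _).aemeasurable
  simp only [symmetrizedLaw_map_sign] at h
  nth_rewrite 2 [← h]
  rw [lintegral_map hF (by fun_prop)]

/-- The symmetrized product law is invariant under coordinatewise signs, so the integrand may be
averaged over all of them. For fixed `w` the contraction bound applies to `w i * h i t`; the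
resulting product of `cosh (c i * w i)` integrates factor by factor. -/
theorem lintegral_exp_iSup_le {κ : Type*} [Fintype κ] [DecidableEq κ] [Nonempty κ]
    {ν : Fin n → Measure ℝ} [∀ i, IsProbabilityMeasure (ν i)] {K γ : ℝ} (hK : 0 < K)
    (hν : ∀ i, IsSubGaussianLaw (ν i) K γ) {v : ι → κ → ℝ} {V : ℝ} (hv : ∀ t, ∑ k, |v t k| ≤ V)
    (h : Fin n → ι → ℝ) (H b : Fin n → ℝ) (hb : ∀ i, 0 ≤ b i) (hH : ∀ i t, |h i t| ≤ H i)
    (hlip : ∀ i s t, |h i s - h i t| ≤ b i * Real.sqrt (∑ k, (v s k - v t k) ^ 2)) :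
    ∫⁻ w, ENNReal.ofReal (Real.exp (⨆ t, ∑ i, w i * h i t)) ∂Measure.pi ν ≤
      ENNReal.ofReal (2 * Fintype.card κ *
        Real.exp ((K ^ 2 / 2 + 2 * γ ^ 2) * ∑ i, (H i + V * (6 * b i)) ^ 2)) := by
  refine (lintegral_exp_iSup_le_symmetrized (fun i => (hν i).integrable_id hK)
    (fun i => (hν i).centered) hH).trans ?_
  set N := Measure.pi fun i => symmetrizedLaw (ν i) with hN
  set Z : (Fin n → ℝ) → ℝ := fun w => ⨆ t, ∑ i, w i * h i t with hZ
  have hZm : Measurable fun w => ENNReal.ofReal (Real.exp (Z w)) :=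
    (Real.measurable_exp.comp (continuous_iSup_sum_mul hH).measurable).ennreal_ofReal
  set c : Fin n → ℝ := fun i => H i + V * (6 * b i) with hc
  set S := ∫⁻ w, ENNReal.ofReal (Real.exp (Z w)) ∂N with hS
  have hbound : ∀ w : Fin n → ℝ,
      𝔼 δ : Fin n → ℤˣ, Real.exp (Z fun i => ((δ i : ℤ) : ℝ) * w i) ≤
        2 * Fintype.card κ * ∏ i, Real.cosh (c i * w i) := by
    intro w
    have h1 := expect_exp_iSup_sign_le hv (fun i t => w i * h i t) (fun i => |w i| * H i)
      (fun i => |w i| * b i) (fun i => mul_nonneg (abs_nonneg _) (hb i))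
      (fun i t => by
        rw [abs_mul]
        exact mul_le_mul_of_nonneg_left (hH i t) (abs_nonneg _))
      (fun i s t => by
        rw [← mul_sub, abs_mul, mul_assoc]
        exact mul_le_mul_of_nonneg_left (hlip i s t) (abs_nonneg _))
    simp only [hZ, mul_assoc] at h1 ⊢
    refine h1.trans (le_of_eq ?_)
    congr 2
    refine Finset.prod_congr rfl fun i _ => ?_
    rw [← Real.cosh_abs (c i * w i), ← Real.cosh_abs]
    congr 1
    rw [show |w i| * H i + V * (6 * (|w i| * b i)) = c i * |w i| by simp only [hc]; ring, abs_mul,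
      abs_mul, abs_abs]
  have hcm : ∀ i, Measurable fun x : ℝ => ENNReal.ofReal (Real.cosh (c i * x)) := fun i =>
    (Real.measurable_cosh.comp (measurable_const_mul _)).ennreal_ofReal
  have hprod : ∫⁻ w : Fin n → ℝ, ∏ i, ENNReal.ofReal (Real.cosh (c i * w i)) ∂N ≤
      ENNReal.ofReal (Real.exp ((K ^ 2 / 2 + 2 * γ ^ 2) * ∑ i, c i ^ 2)) := by
    have hind : iIndepFun (fun i (w : Fin n → ℝ) => ENNReal.ofReal (Real.cosh (c i * w i))) N :=
      iIndepFun_pi (X := fun i x => ENNReal.ofReal (Real.cosh (c i * x)))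
        fun i => (hcm i).aemeasurable
    rw [lintegral_prod_eq_prod_lintegral_of_indepFun Finset.univ _ hind
      fun i => (hcm i).comp (measurable_pi_apply i), Finset.mul_sum, Real.exp_sum,
      ENNReal.ofReal_prod_of_nonneg fun i _ => (Real.exp_pos _).le]
    refine Finset.prod_le_prod' fun i _ => ?_
    rw [(measurePreserving_eval (fun i => symmetrizedLaw (ν i)) i).lintegral_comp (hcm i)]
    exact (hν i).lintegral_cosh_le hK (c i)
  have hcard : (0 : ℝ) < Fintype.card (Fin n → ℤˣ) := by exact_mod_cast Fintype.card_pos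
  have h1 : ∀ w : Fin n → ℝ,
      ∑ δ : Fin n → ℤˣ, ENNReal.ofReal (Real.exp (Z fun i => ((δ i : ℤ) : ℝ) * w i)) ≤
        Fintype.card (Fin n → ℤˣ) * (ENNReal.ofReal (2 * Fintype.card κ) *
          ∏ i, ENNReal.ofReal (Real.cosh (c i * w i))) := by
    intro w
    rw [← ENNReal.ofReal_sum_of_nonneg fun δ _ => (Real.exp_pos _).le,
      ← ENNReal.ofReal_prod_of_nonneg fun i _ => (Real.cosh_pos _).le,
      ← ENNReal.ofReal_mul (by positivity), ← ENNReal.ofReal_natCast,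
      ← ENNReal.ofReal_mul hcard.le]
    apply ENNReal.ofReal_le_ofReal
    have := hbound w
    rwa [Fintype.expect_eq_sum_div_card, div_le_iff₀' hcard] at this
  have h2 : (Fintype.card (Fin n → ℤˣ) : ENNReal) * S ≤ Fintype.card (Fin n → ℤˣ) *
      (ENNReal.ofReal (2 * Fintype.card κ) *
        ENNReal.ofReal (Real.exp ((K ^ 2 / 2 + 2 * γ ^ 2) * ∑ i, c i ^ 2))) := by
    calc (Fintype.card (Fin n → ℤˣ) : ENNReal) * S
        = ∑ δ : Fin n → ℤˣ, ∫⁻ w, ENNReal.ofReal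
            (Real.exp (Z fun i => ((δ i : ℤ) : ℝ) * w i)) ∂N := by
          rw [Finset.sum_congr rfl fun δ _ => lintegral_sign_mul hZm δ, Finset.sum_const,
            Finset.card_univ, nsmul_eq_mul]
      _ = ∫⁻ w, ∑ δ : Fin n → ℤˣ, ENNReal.ofReal
            (Real.exp (Z fun i => ((δ i : ℤ) : ℝ) * w i)) ∂N := by
          rw [lintegral_finsetSum]
          intro δ _
          exact hZm.comp (by fun_prop)
      _ ≤ ∫⁻ w, Fintype.card (Fin n → ℤˣ) * (ENNReal.ofReal (2 * Fintype.card κ) *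
          ∏ i, ENNReal.ofReal (Real.cosh (c i * w i))) ∂N := lintegral_mono h1
      _ = Fintype.card (Fin n → ℤˣ) * (ENNReal.ofReal (2 * Fintype.card κ) *
          ∫⁻ w, ∏ i, ENNReal.ofReal (Real.cosh (c i * w i)) ∂N) := by
          rw [lintegral_const_mul' _ _ (ENNReal.natCast_ne_top _),
            lintegral_const_mul' _ _ ENNReal.ofReal_ne_top]
      _ ≤ _ := by gcongr
  rw [ENNReal.ofReal_mul (by positivity)]
  exact (ENNReal.mul_le_mul_iff_right (by simp) (by simp)).1 h2

theorem measure_le_iSup_le {κ Ω : Type*} [Fintype κ] [DecidableEq κ] [Nonempty κ]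
    [MeasurableSpace Ω] {μ : Measure Ω} [IsProbabilityMeasure μ] {u : Fin n → Ω → ℝ} {K γ : ℝ}
    (hK : 0 < K) (hu : IsSubGaussianNoise μ u K γ) {v : ι → κ → ℝ} {V : ℝ}
    (hv : ∀ t, ∑ k, |v t k| ≤ V) (h : Fin n → ι → ℝ) (H b : Fin n → ℝ) (hb : ∀ i, 0 ≤ b i)
    (hH : ∀ i t, |h i t| ≤ H i)
    (hlip : ∀ i s t, |h i s - h i t| ≤ b i * Real.sqrt (∑ k, (v s k - v t k) ^ 2))
    {s : ℝ} (hs : 0 ≤ s) (T : ℝ) :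
    μ {ω | T ≤ ⨆ t, ∑ i, u i ω * h i t} ≤
      ENNReal.ofReal (2 * Fintype.card κ * Real.exp
        ((K ^ 2 / 2 + 2 * γ ^ 2) * (s ^ 2 * ∑ i, (H i + V * (6 * b i)) ^ 2) - s * T)) := by
  have hprob : ∀ i, IsProbabilityMeasure (μ.map (u i)) := fun i =>
    Measure.isProbabilityMeasure_map (hu.measurable i).aemeasurable
  have hlaw : ∀ i, IsSubGaussianLaw (μ.map (u i)) K γ := by
    intro i
    have hm : AEStronglyMeasurable (fun x : ℝ => Real.exp (|x| ^ 2 / K ^ 2)) (μ.map (u i)) := by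
      fun_prop
    refine ⟨?_, ?_, ?_⟩
    · rw [integral_map (hu.measurable i).aemeasurable (by fun_prop)]
      exact hu.centered i
    · rw [integrable_map_measure hm (hu.measurable i).aemeasurable]
      exact hu.integrable_exp i
    · rw [integral_map (hu.measurable i).aemeasurable hm]
      exact hu.subGaussian i
  have hum : Measurable fun ω i => u i ω := measurable_pi_lambda _ hu.measurable
  have hpi := (iIndepFun_iff_map_fun_eq_pi_map fun i => (hu.measurable i).aemeasurable).1 hu.indep
  have hmain := lintegral_exp_iSup_le hK hlaw hv (fun i t => s * h i t) (fun i => s * H i)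
    (fun i => s * b i) (fun i => mul_nonneg hs (hb i))
    (fun i t => by
      rw [abs_mul, abs_of_nonneg hs]
      exact mul_le_mul_of_nonneg_left (hH i t) hs)
    (fun i x t => by
      rw [← mul_sub, abs_mul, abs_of_nonneg hs, mul_assoc]
      exact mul_le_mul_of_nonneg_left (hlip i x t) hs)
  have hsup : ∀ w : Fin n → ℝ, (⨆ t, ∑ i, w i * (s * h i t)) = s * ⨆ t, ∑ i, w i * h i t := by
    intro w
    rw [Real.mul_iSup_of_nonneg hs]
    refine iSup_congr fun t => ?_
    rw [Finset.mul_sum]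
    exact Finset.sum_congr rfl fun i _ => by ring
  have hsum : ∑ i, (s * H i + V * (6 * (s * b i))) ^ 2 =
      s ^ 2 * ∑ i, (H i + V * (6 * b i)) ^ 2 := by
    rw [Finset.mul_sum]
    exact Finset.sum_congr rfl fun i _ => by ring
  have hZm : Measurable fun w : Fin n → ℝ =>
      ENNReal.ofReal (Real.exp (s * ⨆ t, ∑ i, w i * h i t)) :=
    (Real.measurable_exp.comp
      ((continuous_iSup_sum_mul hH).measurable.const_mul s)).ennreal_ofReal
  simp only [hsup, hsum] at hmain
  rw [← hpi, lintegral_map hZm hum] at hmain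
  have hmarkov := mul_meas_ge_le_lintegral (μ := μ) (hZm.comp hum)
    (ENNReal.ofReal (Real.exp (s * T)))
  have hsub : {ω | T ≤ ⨆ t, ∑ i, u i ω * h i t} ⊆
      {ω | ENNReal.ofReal (Real.exp (s * T)) ≤ ((fun w : Fin n → ℝ =>
        ENNReal.ofReal (Real.exp (s * ⨆ t, ∑ i, w i * h i t))) ∘ fun ω i => u i ω) ω} := by
    intro ω hω
    exact ENNReal.ofReal_le_ofReal
      (Real.exp_le_exp.2 (mul_le_mul_of_nonneg_left hω hs))
  have hpos : ENNReal.ofReal (Real.exp (s * T)) ≠ 0 := by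
    simp [Real.exp_pos]
  have hfin := (mul_le_mul_right (measure_mono hsub) _).trans (hmarkov.trans hmain)
  rw [mul_comm, ← ENNReal.le_div_iff_mul_le (Or.inl hpos) (Or.inl ENNReal.ofReal_ne_top),
    ← ENNReal.ofReal_div_of_pos (Real.exp_pos _), mul_div_assoc, ← Real.exp_sub] at hfin
  exact hfin

theorem IsSubGaussianNoise.neg {Ω : Type*} [MeasurableSpace Ω] {μ : Measure Ω}
    {u : Fin n → Ω → ℝ} {K γ : ℝ} (hu : IsSubGaussianNoise μ u K γ) :
    IsSubGaussianNoise μ (fun i ω => -u i ω) K γ where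
  measurable i := (hu.measurable i).neg
  indep := hu.indep.comp (fun _ x => -x) fun _ => measurable_neg
  centered i := by rw [integral_neg, hu.centered i, neg_zero]
  integrable_exp i := by simpa only [abs_neg] using hu.integrable_exp i
  subGaussian i := by simpa only [abs_neg] using hu.subGaussian i

theorem exists_event_abs_sum_le {κ Ω : Type*} [Fintype κ] [DecidableEq κ] [Nonempty κ]
    [MeasurableSpace Ω] {μ : Measure Ω} [IsProbabilityMeasure μ] {u : Fin n → Ω → ℝ} {K γ : ℝ}
    (hn : 0 < n) (hK : 0 < K) (hu : IsSubGaussianNoise μ u K γ) {v : ι → κ → ℝ} {V : ℝ}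
    (hv : ∀ t, ∑ k, |v t k| ≤ V) (h : Fin n → ι → ℝ) (H b : Fin n → ℝ) (hb : ∀ i, 0 ≤ b i)
    (hH : ∀ i t, |h i t| ≤ H i)
    (hlip : ∀ i s t, |h i s - h i t| ≤ b i * Real.sqrt (∑ k, (v s k - v t k) ^ 2))
    (hQ : 0 < ∑ i, (H i + V * (6 * b i)) ^ 2) :
    ∃ E : Set Ω, MeasurableSet E ∧ 1 - 1 / (n : ℝ) ≤ μ.real E ∧ ∀ ω ∈ E, ∀ t,
      |∑ i, u i ω * h i t| ≤ 2 * Real.sqrt ((K ^ 2 / 2 + 2 * γ ^ 2) *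
        (∑ i, (H i + V * (6 * b i)) ^ 2) * Real.log (4 * Fintype.card κ * n)) := by
  set Q := ∑ i, (H i + V * (6 * b i)) ^ 2 with hQdef
  set σ := K ^ 2 / 2 + 2 * γ ^ 2 with hσ
  have hσ0 : 0 < σ := by positivity
  have hn' : (1 : ℝ) ≤ n := by exact_mod_cast hn
  have hκ : (1 : ℝ) ≤ Fintype.card κ := by exact_mod_cast Fintype.card_pos (α := κ)
  have harg : 1 ≤ 4 * (Fintype.card κ : ℝ) * n := by nlinarith
  set R := Real.log (4 * Fintype.card κ * n) with hR
  have hR0 : 0 ≤ R := Real.log_nonneg harg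
  set T := 2 * Real.sqrt (σ * Q * R) with hT
  have hT0 : 0 ≤ T := by positivity
  have hT2 : T ^ 2 = 4 * (σ * Q * R) := by
    rw [hT, mul_pow, Real.sq_sqrt (by positivity)]
    norm_num
  have htail : ∀ u' : Fin n → Ω → ℝ, IsSubGaussianNoise μ u' K γ →
      μ {ω | T ≤ ⨆ t, ∑ i, u' i ω * h i t} ≤ ENNReal.ofReal (1 / (2 * n)) := by
    intro u' hu'
    -- This `s` minimizes the exponent `σ Q s² - s T`, whose value is then `-R`. The prefactor times
    -- `exp (-R)` is `1 / (2n)`, half of the allowance for the two tails.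
    refine (measure_le_iSup_le hK hu' hv h H b hb hH hlip (s := T / (2 * σ * Q))
      (by positivity) T).trans (ENNReal.ofReal_le_ofReal (le_of_eq ?_))
    rw [← hσ, ← hQdef]
    have e : σ * ((T / (2 * σ * Q)) ^ 2 * Q) - T / (2 * σ * Q) * T = -R := by
      have : σ * ((T / (2 * σ * Q)) ^ 2 * Q) - T / (2 * σ * Q) * T = -(T ^ 2 / (4 * (σ * Q))) := by
        field_simp
        ring
      rw [this, hT2]
      field_simp
    rw [e, Real.exp_neg, hR, Real.exp_log (by linarith)]
    field_simp
    ring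
  set Z : (Fin n → ℝ) → ℝ := fun w => ⨆ t, ∑ i, w i * h i t with hZ
  have hZm : Measurable Z := (continuous_iSup_sum_mul hH).measurable
  have hmeas : ∀ u' : Fin n → Ω → ℝ, IsSubGaussianNoise μ u' K γ →
      MeasurableSet {ω | T ≤ ⨆ t, ∑ i, u' i ω * h i t} := fun u' hu' =>
    measurableSet_le measurable_const (hZm.comp (measurable_pi_lambda _ hu'.measurable))
  set B := {ω | T ≤ ⨆ t, ∑ i, u i ω * h i t} ∪ {ω | T ≤ ⨆ t, ∑ i, -u i ω * h i t} with hB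
  have hBm : MeasurableSet B := (hmeas u hu).union (hmeas _ hu.neg)
  have hBle : μ.real B ≤ 1 / n := by
    have h1 : μ B ≤ ENNReal.ofReal (1 / n) := by
      refine (measure_union_le _ _).trans ((add_le_add (htail u hu) (htail _ hu.neg)).trans ?_)
      rw [← ENNReal.ofReal_add (by positivity) (by positivity)]
      apply ENNReal.ofReal_le_ofReal
      field_simp
      norm_num
    exact ENNReal.toReal_le_of_le_ofReal (by positivity) h1
  refine ⟨Bᶜ, hBm.compl, ?_, fun ω hω t => ?_⟩
  · rw [measureReal_compl hBm, probReal_univ]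
    linarith
  · simp only [hB, Set.mem_compl_iff, Set.mem_union, Set.mem_ofPred_eq, not_or, not_le] at hω
    rw [abs_le]
    constructor
    · have := (le_ciSup (bddAbove_range_sum_mul hH fun i => -u i ω) t).trans hω.2.le
      simp only [neg_mul, Finset.sum_neg_distrib] at this
      linarith
    · exact (le_ciSup (bddAbove_range_sum_mul hH fun i => u i ω) t).trans hω.1.le

end SignedSums

/-! ### Matrix norms and an arithmetic-geometric mean bound -/

/-- The Frobenius norm of a matrix. -/
noncomputable def frobNorm {ι κ : Type*} [Fintype ι] [Fintype κ] (B : Matrix ι κ ℝ) : ℝ :=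
  Real.sqrt (∑ i, ∑ j, B i j ^ 2)

theorem frobNorm_nonneg {ι κ : Type*} [Fintype ι] [Fintype κ] (B : Matrix ι κ ℝ) :
    0 ≤ frobNorm B := Real.sqrt_nonneg _

theorem frobNorm_sq {ι κ : Type*} [Fintype ι] [Fintype κ] (B : Matrix ι κ ℝ) :
    frobNorm B ^ 2 = ∑ i, ∑ j, B i j ^ 2 :=
  Real.sq_sqrt (Finset.sum_nonneg fun _ _ => Finset.sum_nonneg fun _ _ => sq_nonneg _)

theorem sum_sq_le_sum_abs_sq {ι : Type*} (s : Finset ι) (f : ι → ℝ) :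
    ∑ i ∈ s, f i ^ 2 ≤ (∑ i ∈ s, |f i|) ^ 2 := by
  rw [sq, Finset.sum_mul]
  refine Finset.sum_le_sum fun i hi => ?_
  rw [← sq_abs, sq]
  exact mul_le_mul_of_nonneg_left
    (Finset.single_le_sum (f := fun i => |f i|) (fun _ _ => abs_nonneg _) hi) (abs_nonneg _)

theorem frobNorm_le_matrixL1 {ι κ : Type*} [Fintype ι] [Fintype κ] (B : Matrix ι κ ℝ) :
    frobNorm B ≤ matrixL1 B := by
  refine Real.sqrt_le_iff.2 ⟨matrixL1_nonneg B, ?_⟩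
  have h := sum_sq_le_sum_abs_sq Finset.univ fun z : ι × κ => B z.1 z.2
  simpa only [Fintype.sum_prod_type, matrixL1] using h

theorem norm_euclMap_le {ι κ : Type*} [Fintype ι] [Fintype κ] [DecidableEq κ] (G : Matrix ι κ ℝ)
    (v : EuclideanSpace ℝ κ) : ‖euclMap G v‖ ≤ frobNorm G * ‖v‖ := by
  rw [← pow_le_pow_iff_left₀ (norm_nonneg _) (mul_nonneg (frobNorm_nonneg _) (norm_nonneg _))
    two_ne_zero, mul_pow, frobNorm_sq, EuclideanSpace.norm_sq_eq, EuclideanSpace.norm_sq_eq,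
    Finset.sum_mul]
  refine Finset.sum_le_sum fun i _ => ?_
  rw [euclMap_apply, Real.norm_eq_abs, sq_abs]
  simp only [Real.norm_eq_abs, sq_abs]
  exact Finset.sum_mul_sq_le_sq_mul_sq _ _ _

theorem euclMap_sub_left {ι κ : Type*} [Fintype ι] [Fintype κ] [DecidableEq κ]
    (G G' : Matrix ι κ ℝ) (v : EuclideanSpace ℝ κ) :
    euclMap (G - G') v = euclMap G v - euclMap G' v := by
  simp [euclMap]

theorem euclMap_smul_left {ι κ : Type*} [Fintype ι] [Fintype κ] [DecidableEq κ] (c : ℝ)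
    (G : Matrix ι κ ℝ) (v : EuclideanSpace ℝ κ) : euclMap (c • G) v = c • euclMap G v := by
  simp [euclMap]

theorem matrixL1_smul {ι κ : Type*} [Fintype ι] [Fintype κ] (c : ℝ) (B : Matrix ι κ ℝ) :
    matrixL1 (c • B) = |c| * matrixL1 B := by
  simp [matrixL1, abs_mul, Finset.mul_sum]

theorem eq_zero_of_matrixL1_eq_zero {ι κ : Type*} [Fintype ι] [Fintype κ] {B : Matrix ι κ ℝ}
    (h : matrixL1 B = 0) : B = 0 := by
  ext i j
  have h1 := (Finset.sum_eq_zero_iff_of_nonneg fun i _ =>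
    Finset.sum_nonneg fun j _ => abs_nonneg (B i j)).1 h i (Finset.mem_univ i)
  exact abs_eq_zero.1 ((Finset.sum_eq_zero_iff_of_nonneg fun j _ => abs_nonneg (B i j)).1 h1 j
    (Finset.mem_univ j))

/-- AM-GM, obtained by multiplying the inequalities `n c i ≤ exp (n c i - 1)`. -/
theorem prod_le_inv_pow_of_sum_le_one {n : ℕ} (hn : 0 < n) (c : Fin n → ℝ) (hc : ∀ i, 0 ≤ c i)
    (h : ∑ i, c i ≤ 1) : ∏ i, c i ≤ ((n : ℝ)⁻¹) ^ n := by
  have hn' : (0 : ℝ) < n := by exact_mod_cast hn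
  have h1 : ∏ i, (n * c i) ≤ 1 := by
    calc ∏ i, ((n : ℝ) * c i) ≤ ∏ i, Real.exp (n * c i - 1) :=
          Finset.prod_le_prod (fun i _ => mul_nonneg hn'.le (hc i)) fun i _ => by
            linarith [Real.add_one_le_exp (n * c i - 1)]
      _ = Real.exp (n * ∑ i, c i - n) := by
          rw [← Real.exp_sum, Finset.sum_sub_distrib, ← Finset.mul_sum]
          simp
      _ ≤ 1 := by
          rw [Real.exp_le_one_iff]
          nlinarith
  rw [Finset.prod_mul_distrib, Finset.prod_const, Finset.card_univ, Fintype.card_fin] at h1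
  rw [inv_pow, ← one_div, le_div_iff₀ (by positivity)]
  linarith

/-! ### Boundedness, Lipschitz continuity and homogeneity of networks -/

namespace NetArch

variable {L : ℕ} (p : NetArch L)

theorem IsAdmissible.norm_le {p : NetArch L} {f : p.Activations} {a : ℝ} (hf : p.IsAdmissible f a)
    (l : Fin L) (z : EuclideanSpace ℝ (Fin (p.width ((l : ℕ) + 1)))) : ‖f l z‖ ≤ a * ‖z‖ := by
  simpa [hf.map_zero l] using hf.lipschitz l z 0

theorem norm_preAct_le {f : p.Activations} {a : ℝ} (ha : 0 ≤ a) (hf : p.IsAdmissible f a)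
    {Θ : p.Params} (hΘ : ∀ l, matrixL1 (Θ l) ≤ 1) (x : p.Input) :
    ∀ (k : ℕ) (hk : k ≤ L), ‖p.preAct f Θ x k hk‖ ≤ a ^ k * ‖x‖ := by
  have hmap : ∀ (l : Fin (L + 1)) (z : EuclideanSpace ℝ (Fin (p.width (l : ℕ)))),
      ‖euclMap (Θ l) z‖ ≤ ‖z‖ := fun l z =>
    (norm_euclMap_le _ _).trans (mul_le_of_le_one_left (norm_nonneg _)
      ((frobNorm_le_matrixL1 _).trans (hΘ l)))
  intro k
  induction k with
  | zero => intro hk; exact (hmap 0 x).trans_eq (show ‖x‖ = a ^ 0 * ‖x‖ by rw [pow_zero, one_mul])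
  | succ k ih =>
    intro hk
    calc ‖p.preAct f Θ x (k + 1) hk‖ ≤ ‖f ⟨k, hk⟩ (p.preAct f Θ x k (Nat.le_of_succ_le hk))‖ :=
          hmap ⟨k + 1, Nat.lt_succ_of_le hk⟩ _
      _ ≤ a * ‖p.preAct f Θ x k (Nat.le_of_succ_le hk)‖ := hf.norm_le _ _
      _ ≤ a * (a ^ k * ‖x‖) := by gcongr; exact ih _
      _ = a ^ (k + 1) * ‖x‖ := by ring

/-- The Frobenius distance of the weight matrices of layer `j`, and zero beyond the last layer. -/
noncomputable def layerDist (Θ Θ' : p.Params) (j : ℕ) : ℝ :=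
  if h : j < L + 1 then frobNorm (Θ ⟨j, h⟩ - Θ' ⟨j, h⟩) else 0

/-- The difference splits into an old error passed through the current layer, amplified by at most
`a`, and a new error from the change of this layer's matrix. -/
theorem norm_preAct_sub_le {f : p.Activations} {a : ℝ} (ha : 0 ≤ a) (hf : p.IsAdmissible f a)
    {Θ Θ' : p.Params} (hΘ : ∀ l, matrixL1 (Θ l) ≤ 1) (hΘ' : ∀ l, matrixL1 (Θ' l) ≤ 1)
    (x : p.Input) : ∀ (k : ℕ) (hk : k ≤ L),
      ‖p.preAct f Θ x k hk - p.preAct f Θ' x k hk‖ ≤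
        a ^ k * ‖x‖ * ∑ j ∈ Finset.range (k + 1), p.layerDist Θ Θ' j := by
  intro k
  induction k with
  | zero =>
    intro hk
    have h := (congrArg norm (euclMap_sub_left (Θ 0) (Θ' 0) x)).symm.trans_le
      (norm_euclMap_le _ _)
    have e : ∑ j ∈ Finset.range (0 + 1), p.layerDist Θ Θ' j = frobNorm (Θ 0 - Θ' 0) := by
      rw [zero_add, Finset.sum_range_one]
      exact dif_pos (Nat.succ_pos L)
    rw [e, pow_zero, one_mul, mul_comm]
    exact h
  | succ k ih =>
    intro hk
    set l : Fin (L + 1) := ⟨k + 1, Nat.lt_succ_of_le hk⟩ with hl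
    set z := p.preAct f Θ x k (Nat.le_of_succ_le hk)
    set z' := p.preAct f Θ' x k (Nat.le_of_succ_le hk)
    have e : p.preAct f Θ x (k + 1) hk - p.preAct f Θ' x (k + 1) hk =
        euclMap (Θ l) (f ⟨k, hk⟩ z - f ⟨k, hk⟩ z') + euclMap (Θ l - Θ' l) (f ⟨k, hk⟩ z') := by
      rw [map_sub, euclMap_sub_left]
      simp only [preAct]
      abel
    have hd : p.layerDist Θ Θ' (k + 1) = frobNorm (Θ l - Θ' l) :=
      dif_pos (Nat.lt_succ_of_le hk)
    rw [e, Finset.sum_range_succ _ (k + 1), hd]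
    have h1 : ‖euclMap (Θ l) (f ⟨k, hk⟩ z - f ⟨k, hk⟩ z')‖ ≤
        a * (a ^ k * ‖x‖ * ∑ j ∈ Finset.range (k + 1), p.layerDist Θ Θ' j) := by
      refine (norm_euclMap_le _ _).trans ((mul_le_of_le_one_left (norm_nonneg _)
        ((frobNorm_le_matrixL1 _).trans (hΘ l))).trans ((hf.lipschitz _ _ _).trans ?_))
      gcongr
      exact ih _
    have h2 : ‖euclMap (Θ l - Θ' l) (f ⟨k, hk⟩ z')‖ ≤
        frobNorm (Θ l - Θ' l) * (a * (a ^ k * ‖x‖)) := by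
      refine (norm_euclMap_le _ _).trans ?_
      gcongr
      · exact frobNorm_nonneg _
      · exact (hf.norm_le _ _).trans (by gcongr; exact p.norm_preAct_le ha hf hΘ' x k _)
    refine (norm_add_le _ _).trans ((add_le_add h1 h2).trans (le_of_eq ?_))
    ring

theorem preAct_smul {f : p.Activations} {a : ℝ} (hf : p.IsAdmissible f a) (c : ℕ → ℝ)
    (hc : ∀ j, 0 ≤ c j) (Θ : p.Params) (x : p.Input) : ∀ (k : ℕ) (hk : k ≤ L),
      p.preAct f (fun l => c l • Θ l) x k hk =
        (∏ j ∈ Finset.range (k + 1), c j) • p.preAct f Θ x k hk := by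
  intro k
  induction k with
  | zero =>
    intro hk
    have e : ∏ j ∈ Finset.range (0 + 1), c j = c 0 := by simp
    rw [e]
    exact euclMap_smul_left _ _ _
  | succ k ih =>
    intro hk
    simp only [preAct]
    rw [ih, hf.homogeneous _ _ _ (Finset.prod_nonneg fun j _ => hc j), euclMap_smul_left,
      map_smul, smul_smul, Finset.prod_range_succ _ (k + 1), mul_comm]

theorem abs_net_le {f : p.Activations} {a : ℝ} (ha : 0 ≤ a) (hf : p.IsAdmissible f a)
    {Θ : p.Params} (hΘ : ∀ l, matrixL1 (Θ l) ≤ 1) (x : p.Input) :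
    |p.net f Θ x| ≤ a ^ L * ‖x‖ :=
  (PiLp.norm_apply_le (p.preAct f Θ x L le_rfl) _).trans (p.norm_preAct_le ha hf hΘ x L le_rfl)

/-- Positions of the entries of the weight matrices. -/
abbrev ParamIndex : Type :=
  (l : Fin (L + 1)) × Fin (p.width ((l : ℕ) + 1)) × Fin (p.width (l : ℕ))

/-- The vector of all entries of the weight matrices. -/
def flatten (Θ : p.Params) (k : p.ParamIndex) : ℝ := Θ k.1 k.2.1 k.2.2

theorem card_paramIndex : Fintype.card p.ParamIndex = p.numParams := by
  simp [ParamIndex, numParams]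

theorem sum_abs_flatten (Θ : p.Params) : ∑ k, |p.flatten Θ k| = ∑ l, matrixL1 (Θ l) := by
  simp only [flatten, matrixL1, Fintype.sum_sigma, Fintype.sum_prod_type]

theorem sum_layerDist_le (Θ Θ' : p.Params) :
    ∑ j ∈ Finset.range (L + 1), p.layerDist Θ Θ' j ≤
      Real.sqrt (L + 1) * Real.sqrt (∑ k, (p.flatten Θ k - p.flatten Θ' k) ^ 2) := by
  have h1 : ∑ j ∈ Finset.range (L + 1), p.layerDist Θ Θ' j =
      ∑ l : Fin (L + 1), frobNorm (Θ l - Θ' l) := by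
    rw [Finset.sum_range]
    exact Finset.sum_congr rfl fun l _ => dif_pos l.2
  have h2 : ∑ k, (p.flatten Θ k - p.flatten Θ' k) ^ 2 =
      ∑ l : Fin (L + 1), frobNorm (Θ l - Θ' l) ^ 2 := by
    simp only [frobNorm_sq, flatten, Fintype.sum_sigma, Fintype.sum_prod_type, Matrix.sub_apply]
  rw [h1, h2, ← Real.sqrt_mul (by positivity)]
  apply Real.le_sqrt_of_sq_le
  have := sq_sum_le_card_mul_sum_sq (s := Finset.univ) (f := fun l => frobNorm (Θ l - Θ' l))
  simpa using this

theorem abs_net_sub_le {f : p.Activations} {a : ℝ} (ha : 0 ≤ a) (hf : p.IsAdmissible f a)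
    {Θ Θ' : p.Params} (hΘ : ∀ l, matrixL1 (Θ l) ≤ 1) (hΘ' : ∀ l, matrixL1 (Θ' l) ≤ 1)
    (x : p.Input) : |p.net f Θ x - p.net f Θ' x| ≤ a ^ L * ‖x‖ * Real.sqrt (L + 1) *
      Real.sqrt (∑ k, (p.flatten Θ k - p.flatten Θ' k) ^ 2) := by
  have h := (PiLp.norm_apply_le (p.preAct f Θ x L le_rfl - p.preAct f Θ' x L le_rfl)
    ⟨0, p.width_pos (L + 1) le_rfl⟩).trans (p.norm_preAct_sub_le ha hf hΘ hΘ' x L le_rfl)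
  refine (show _ ≤ _ from h).trans ?_
  rw [mul_assoc (a ^ L * ‖x‖)]
  gcongr
  exact p.sum_layerDist_le Θ Θ'

/-- Nonnegative layer norms pull out through homogeneous activations as one scalar, their product,
which AM-GM bounds under the sum constraint. -/
theorem exists_normalized {f : p.Activations} {a : ℝ} (hf : p.IsAdmissible f a) {Θ : p.Params}
    (hΘ : ∑ l, matrixL1 (Θ l) ≤ 1) :
    ∃ (Θ' : p.Params) (c : ℝ), (∀ l, matrixL1 (Θ' l) ≤ 1) ∧ 0 ≤ c ∧
      c ≤ (((L : ℝ) + 1)⁻¹) ^ (L + 1) ∧ ∀ x, p.net f Θ x = c * p.net f Θ' x := by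
  set c : ℕ → ℝ := fun j => if h : j < L + 1 then matrixL1 (Θ ⟨j, h⟩) else 0 with hcdef
  have hc : ∀ j, 0 ≤ c j := by
    intro j
    simp only [hcdef]
    split
    · exact matrixL1_nonneg _
    · exact le_rfl
  have hcl : ∀ l : Fin (L + 1), c l = matrixL1 (Θ l) := fun l => dif_pos l.2
  -- A layer of norm zero is the zero matrix, so the convention `0⁻¹ = 0` does no harm.
  have heq : (fun l : Fin (L + 1) => c l • (c l)⁻¹ • Θ l) = Θ := by
    funext l
    rcases eq_or_ne (c l) 0 with h0 | h0
    · rw [h0, zero_smul, eq_zero_of_matrixL1_eq_zero ((hcl l).symm.trans h0)]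
    · rw [smul_inv_smul₀ h0]
  refine ⟨fun l => (c l)⁻¹ • Θ l, ∏ j ∈ Finset.range (L + 1), c j, fun l => ?_,
    Finset.prod_nonneg fun j _ => hc j, ?_, fun x => ?_⟩
  · rw [matrixL1_smul, abs_of_nonneg (inv_nonneg.2 (hc l)), ← hcl]
    exact inv_mul_le_one
  · rw [Finset.prod_range]
    have := prod_le_inv_pow_of_sum_le_one (Nat.succ_pos L) (fun l : Fin (L + 1) => c l)
      (fun l => hc l) (by simpa only [hcl] using hΘ)
    simpa using this
  · have h := p.preAct_smul hf c hc (fun l => (c l)⁻¹ • Θ l) x L le_rfl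
    rw [heq] at h
    simp only [net, h, PiLp.smul_apply, smul_eq_mul]

end NetArch

/-! ### Oracle inequality and calibration of the tuning parameter -/

namespace NetArch

variable {L : ℕ} (p : NetArch L)

theorem predErr_sq (f : p.Activations) {n : ℕ} (x : Fin n → p.Input) (g : p.Input → ℝ) (κ : ℝ)
    (Θ : p.Params) :
    p.predErr f x g κ Θ ^ 2 = 1 / (n : ℝ) * ∑ i, (g (x i) - κ * p.net f Θ (x i)) ^ 2 :=
  Real.sq_sqrt (mul_nonneg (by positivity) (Finset.sum_nonneg fun _ _ => sq_nonneg _))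

theorem objective_eq (f : p.Activations) {n : ℕ} (x : Fin n → p.Input) (g : p.Input → ℝ)
    (w : Fin n → ℝ) (lam κ : ℝ) (Θ : p.Params) :
    p.objective f x (fun i => g (x i) + w i) lam κ Θ =
      p.predErr f x g κ Θ ^ 2 + 1 / (n : ℝ) * ∑ i, (2 * w i * g (x i) + w i ^ 2) -
        κ * (2 / (n : ℝ) * ∑ i, w i * p.net f Θ (x i)) + lam * κ := by
  have h : ∑ i, (g (x i) + w i - κ * p.net f Θ (x i)) ^ 2 =
      ∑ i, (g (x i) - κ * p.net f Θ (x i)) ^ 2 + ∑ i, (2 * w i * g (x i) + w i ^ 2) -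
        2 * κ * ∑ i, w i * p.net f Θ (x i) := by
    rw [Finset.mul_sum, ← Finset.sum_add_distrib, ← Finset.sum_sub_distrib]
    exact Finset.sum_congr rfl fun i _ => by ring
  rw [objective, predErr_sq, h]
  ring

/-- In the minimality inequality the pure-noise terms cancel. The estimator's noise term, at most
`lam * κ`, is absorbed by its own penalty; the competitor's adds another `lam * κ'`, whence the
factor `2`. -/
theorem predErr_sq_le_iInf {f : p.Activations} {n : ℕ} {x : Fin n → p.Input} {g : p.Input → ℝ}
    {w : Fin n → ℝ} {lam ν κ : ℝ} {Θ : p.Params}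
    (hw : ∀ Θ ∈ p.unitBall ν, |2 / (n : ℝ) * ∑ i, w i * p.net f Θ (x i)| ≤ lam)
    (hest : p.IsEstimator f x (fun i => g (x i) + w i) lam ν κ Θ) :
    p.predErr f x g κ Θ ^ 2 ≤
      ⨅ q : {q : ℝ × p.Params // 0 ≤ q.1 ∧ q.2 ∈ p.unitBall ν},
        (p.predErr f x g q.1.1 q.1.2 ^ 2 + 2 * lam * q.1.1) := by
  obtain ⟨hκ, hΘ, hmin⟩ := hest
  have : Nonempty {q : ℝ × p.Params // 0 ≤ q.1 ∧ q.2 ∈ p.unitBall ν} := ⟨⟨(κ, Θ), hκ, hΘ⟩⟩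
  refine le_ciInf fun ⟨⟨κ', Θ'⟩, hκ', hΘ'⟩ => ?_
  have h := hmin κ' hκ' Θ' hΘ'
  rw [objective_eq, objective_eq] at h
  have h1 := mul_le_mul_of_nonneg_left (abs_le.1 (hw Θ hΘ)).2 hκ
  have h2 := mul_le_mul_of_nonneg_left (abs_le.1 (hw Θ' hΘ')).1 hκ'
  dsimp only at hκ' ⊢
  linarith

theorem inputNorm_sq {n : ℕ} (x : Fin n → p.Input) :
    p.inputNorm x ^ 2 = (∑ i, ‖x i‖ ^ 2) / n :=
  Real.sq_sqrt (div_nonneg (Finset.sum_nonneg fun _ _ => sq_nonneg _) n.cast_nonneg)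

theorem inputNorm_nonneg {n : ℕ} (x : Fin n → p.Input) : 0 ≤ p.inputNorm x := Real.sqrt_nonneg _

theorem abs_noise_le_of_normalized {f : p.Activations} {a : ℝ} (hf : p.IsAdmissible f a) {n : ℕ}
    {x : Fin n → p.Input} {w : Fin n → ℝ} {ν D : ℝ} (hMA : p.MA < 1) (hν : 1 / (1 - p.MA) ≤ ν)
    (hD : ∀ Θ : p.Params, (∀ l, matrixL1 (Θ l) ≤ 1) → |∑ i, w i * p.net f Θ (x i)| ≤ D)
    {Θ : p.Params} (hΘ : Θ ∈ p.unitBall ν) :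
    |2 / (n : ℝ) * ∑ i, w i * p.net f Θ (x i)| ≤
      2 / (n : ℝ) * ((((L : ℝ) + 1)⁻¹) ^ (L + 1) * D) := by
  obtain ⟨Θ', c, hΘ', hc0, hc, hnet⟩ :=
    p.exists_normalized hf (p.sum_matrixL1_le_one hMA hν hΘ)
  have e : ∑ i, w i * p.net f Θ (x i) = c * ∑ i, w i * p.net f Θ' (x i) := by
    rw [Finset.mul_sum]
    exact Finset.sum_congr rfl fun i _ => by rw [hnet]; ring
  rw [e, abs_mul, abs_mul, abs_of_nonneg hc0, abs_of_nonneg (by positivity : 0 ≤ 2 / (n : ℝ))]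
  gcongr
  exact hD Θ' hΘ'

theorem numParams_pos : 0 < p.numParams := by
  rw [← p.card_paramIndex, Fintype.card_pos_iff]
  exact ⟨⟨0, ⟨0, p.width_pos _ (by simp)⟩, ⟨0, p.width_pos _ (by simp)⟩⟩⟩

theorem exists_event_abs_noise_le {Ω : Type*} [MeasurableSpace Ω] {μ : Measure Ω}
    [IsProbabilityMeasure μ] {n : ℕ} (hn : 0 < n) {u : Fin n → Ω → ℝ} {K γ : ℝ} (hK : 0 < K)
    (hu : IsSubGaussianNoise μ u K γ) {f : p.Activations} {a : ℝ} (ha : 0 < a)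
    (hf : p.IsAdmissible f a) {x : Fin n → p.Input} (hx : 0 < p.inputNorm x) :
    ∃ E : Set Ω, MeasurableSet E ∧ 1 - 1 / (n : ℝ) ≤ μ.real E ∧ ∀ ω ∈ E, ∀ Θ : p.Params,
      (∀ l, matrixL1 (Θ l) ≤ 1) → |∑ i, u i ω * p.net f Θ (x i)| ≤
        14 * Real.sqrt (K ^ 2 / 2 + 2 * γ ^ 2) * (a ^ L * p.inputNorm x) *
          (Real.sqrt (L + 1) * (L + 1)) * Real.sqrt n *
            Real.sqrt (Real.log (4 * p.numParams * n)) := by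
  set S := Real.sqrt ((L : ℝ) + 1) with hS
  have hS2 : S ^ 2 = (L : ℝ) + 1 := Real.sq_sqrt (by positivity)
  have hS1 : 1 ≤ S := Real.one_le_sqrt.2 (by linarith [(Nat.cast_nonneg L : (0 : ℝ) ≤ L)])
  have hn' : (0 : ℝ) < n := by exact_mod_cast hn
  set X := p.inputNorm x with hX
  have hsumx : ∑ i, ‖x i‖ ^ 2 = n * X ^ 2 := by
    rw [hX, inputNorm_sq]
    field_simp
  -- Here `V = L + 1 = S ^ 2` bounds the ℓ₁-norm of all parameters and `S` comes from the Lipschitz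
  -- constant, which together give `S ^ 3`.
  have hQ : ∑ i, (a ^ L * ‖x i‖ + ((L : ℝ) + 1) * (6 * (a ^ L * ‖x i‖ * S))) ^ 2 =
      (a ^ L * (1 + 6 * S ^ 3)) ^ 2 * (n * X ^ 2) := by
    rw [← hsumx, Finset.mul_sum]
    refine Finset.sum_congr rfl fun i _ => ?_
    rw [← hS2]
    ring
  have : Nonempty {Θ : p.Params // ∀ l, matrixL1 (Θ l) ≤ 1} :=
    ⟨⟨fun _ => 0, fun l => by simp [matrixL1]⟩⟩
  have : Nonempty p.ParamIndex := by
    rw [← Fintype.card_pos_iff, p.card_paramIndex]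
    exact p.numParams_pos
  obtain ⟨E, hE, hμE, hEle⟩ := exists_event_abs_sum_le
    (ι := {Θ : p.Params // ∀ l, matrixL1 (Θ l) ≤ 1}) hn hK hu
    (v := fun Θ => p.flatten Θ.1) (V := (L : ℝ) + 1)
    (fun Θ => by
      rw [sum_abs_flatten]
      refine (Finset.sum_le_sum fun l _ => Θ.2 l).trans_eq ?_
      simp)
    (fun i Θ => p.net f Θ.1 (x i)) (fun i => a ^ L * ‖x i‖) (fun i => a ^ L * ‖x i‖ * S)
    (fun i => by positivity) (fun i Θ => p.abs_net_le ha.le hf Θ.2 (x i))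
    (fun i Θ Θ' => p.abs_net_sub_le ha.le hf Θ.2 Θ'.2 (x i)) (by
      rw [hQ]
      positivity)
  refine ⟨E, hE, hμE, fun ω hω Θ hΘ => (hEle ω hω ⟨Θ, hΘ⟩).trans ?_⟩
  rw [hQ, p.card_paramIndex]
  set R := Real.log (4 * p.numParams * n)
  set σ := K ^ 2 / 2 + 2 * γ ^ 2 with hσ
  have hσ0 : 0 < σ := by positivity
  have e1 : Real.sqrt (σ * ((a ^ L * (1 + 6 * S ^ 3)) ^ 2 * (n * X ^ 2)) * R) =
      Real.sqrt σ * (a ^ L * (1 + 6 * S ^ 3)) * Real.sqrt n * X * Real.sqrt R := by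
    rw [Real.sqrt_mul (by positivity), Real.sqrt_mul hσ0.le, Real.sqrt_mul (by positivity),
      Real.sqrt_mul hn'.le, Real.sqrt_sq (by positivity), Real.sqrt_sq hx.le]
    ring
  have hS3 : 1 + 6 * S ^ 3 ≤ 7 * S ^ 3 := by
    have := one_le_pow₀ hS1 (n := 3)
    linarith
  rw [e1]
  calc 2 * (Real.sqrt σ * (a ^ L * (1 + 6 * S ^ 3)) * Real.sqrt n * X * Real.sqrt R)
      ≤ 2 * (Real.sqrt σ * (a ^ L * (7 * S ^ 3)) * Real.sqrt n * X * Real.sqrt R) := by gcongr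
    _ = _ := by rw [← hS2]; ring

/-- With `W = a^L X √L L^(-L)`, the left side is at most `80 s W √(log 2P) √(log 2n) / √n`. The
prefactor `a^(2L) X² (√2/L)^(2L-1)` on the right is exactly `W` times the size, divided by `√2`. The
comparison thus reduces to `80 s ≤ r √(log 2n) / 2`. -/
theorem penalty_level_bound {n : ℕ} (hn : 0 < n) (hL : 1 ≤ L) {a r s X P : ℝ} (ha : 0 ≤ a)
    (hs : 0 ≤ s) (hX : 0 ≤ X) (hP : 1 ≤ P)
    (hsize : r ≤ a ^ L * Real.sqrt (L : ℝ) * (2 / (L : ℝ)) ^ L * X)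
    (hnr : 160 * s ≤ r * Real.sqrt (Real.log (2 * n))) :
    2 / (n : ℝ) * ((((L : ℝ) + 1)⁻¹) ^ (L + 1) * (14 * s * (a ^ L * X) *
        (Real.sqrt (L + 1) * (L + 1)) * Real.sqrt n * Real.sqrt (Real.log (4 * P * n)))) ≤
      a ^ (2 * L) * X ^ 2 * ((Real.sqrt 2 / (L : ℝ)) ^ (2 * L - 1) *
        Real.sqrt (Real.log (2 * P))) * (Real.log (2 * n) / Real.sqrt n) := by
  have hn' : (1 : ℝ) ≤ n := by exact_mod_cast hn
  have hL' : (1 : ℝ) ≤ L := by exact_mod_cast hL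
  have hL0 : (0 : ℝ) < L := by linarith
  set q := Real.sqrt (n : ℝ) with hq
  have hq0 : 0 < q := Real.sqrt_pos.2 (by linarith)
  have hq2 : (n : ℝ) = q ^ 2 := (Real.sq_sqrt (by linarith)).symm
  set A := Real.log (2 * P) with hA
  set B := Real.log (2 * n) with hB
  have hA0 : 1 / 2 ≤ A := by
    have := Real.log_le_log (by norm_num) (by linarith : (2 : ℝ) ≤ 2 * P)
    linarith [Real.log_two_gt_d9]
  have hB0 : 1 / 2 ≤ B := by
    have := Real.log_le_log (by norm_num) (by linarith : (2 : ℝ) ≤ 2 * n)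
    linarith [Real.log_two_gt_d9]
  have hAB : Real.log (4 * P * n) = A + B := by
    rw [hA, hB, ← Real.log_mul (by positivity) (by positivity)]
    ring_nf
  -- A sum is bounded by a product, `A + B ≤ 4 A B`, because both logarithms are at least `1/2`.
  have hR : Real.sqrt (Real.log (4 * P * n)) ≤ 2 * (Real.sqrt A * Real.sqrt B) := by
    rw [hAB, Real.sqrt_le_left (by positivity), mul_pow, mul_pow, Real.sq_sqrt (by linarith),
      Real.sq_sqrt (by linarith)]
    nlinarith
  have hBs : B = Real.sqrt B * Real.sqrt B := (Real.mul_self_sqrt (by linarith)).symm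
  have h2 : Real.sqrt 2 ^ 2 = 2 := Real.sq_sqrt (by norm_num)
  have h2le : Real.sqrt 2 ≤ 10 / 7 := by
    rw [Real.sqrt_le_left (by norm_num)]
    norm_num
  have h2pos : 0 < Real.sqrt 2 := by positivity
  have hSL : Real.sqrt ((L : ℝ) + 1) ≤ 10 / 7 * Real.sqrt L := by
    rw [Real.sqrt_le_left (by positivity), mul_pow, Real.sq_sqrt hL0.le]
    nlinarith
  set W := a ^ L * X * Real.sqrt L * ((L : ℝ)⁻¹) ^ L with hW
  have hW0 : 0 ≤ W := by positivity
  have hpow : (((L : ℝ) + 1)⁻¹) ^ (L + 1) * ((L : ℝ) + 1) ≤ ((L : ℝ)⁻¹) ^ L := by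
    rw [pow_succ, mul_assoc, inv_mul_cancel₀ (by positivity), mul_one]
    gcongr
    linarith
  have hLHS : 2 / (n : ℝ) * ((((L : ℝ) + 1)⁻¹) ^ (L + 1) * (14 * s * (a ^ L * X) *
        (Real.sqrt (L + 1) * (L + 1)) * q * Real.sqrt (Real.log (4 * P * n)))) ≤
      80 * s * W * Real.sqrt A * Real.sqrt B / q := by
    calc _ = 28 * s * (a ^ L * X) * Real.sqrt (L + 1) *
          ((((L : ℝ) + 1)⁻¹) ^ (L + 1) * ((L : ℝ) + 1)) *
          Real.sqrt (Real.log (4 * P * n)) / q := by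
          rw [hq2]
          field_simp
          ring
      _ ≤ 28 * s * (a ^ L * X) * (10 / 7 * Real.sqrt L) * ((L : ℝ)⁻¹) ^ L *
          (2 * (Real.sqrt A * Real.sqrt B)) / q := by gcongr
      _ = _ := by rw [hW]; ring
  have hRHS : W * r / 2 * Real.sqrt A * B / q ≤
      a ^ (2 * L) * X ^ 2 * ((Real.sqrt 2 / (L : ℝ)) ^ (2 * L - 1) * Real.sqrt A) * (B / q) := by
    have e1 : (Real.sqrt 2 / (L : ℝ)) ^ (2 * L - 1) * (Real.sqrt 2 / (L : ℝ)) =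
        2 ^ L * (((L : ℝ)⁻¹) ^ L * ((L : ℝ)⁻¹) ^ L) := by
      rw [← pow_succ, show 2 * L - 1 + 1 = 2 * L by omega, div_pow, pow_mul, h2, ← pow_add,
        ← two_mul, inv_pow, div_eq_mul_inv]
    have e2 : W * (a ^ L * Real.sqrt (L : ℝ) * (2 / (L : ℝ)) ^ L * X) =
        a ^ (2 * L) * X ^ 2 * (Real.sqrt 2 / (L : ℝ)) ^ (2 * L - 1) * Real.sqrt 2 := by
      have e3 : Real.sqrt (L : ℝ) * Real.sqrt L = L := Real.mul_self_sqrt hL0.le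
      have e4 : (2 / (L : ℝ)) ^ L = 2 ^ L * ((L : ℝ)⁻¹) ^ L := by rw [div_eq_mul_inv, mul_pow]
      have e5 : (Real.sqrt 2 / (L : ℝ)) ^ (2 * L - 1) * Real.sqrt 2 =
          2 ^ L * (((L : ℝ)⁻¹) ^ L * ((L : ℝ)⁻¹) ^ L) * L := by
        rw [← e1]
        field_simp
      calc W * (a ^ L * Real.sqrt (L : ℝ) * (2 / (L : ℝ)) ^ L * X)
          = a ^ (2 * L) * X ^ 2 * (2 ^ L * (((L : ℝ)⁻¹) ^ L * ((L : ℝ)⁻¹) ^ L) *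
            (Real.sqrt (L : ℝ) * Real.sqrt L)) := by rw [hW, e4]; ring
        _ = _ := by rw [e3, ← e5]; ring
    set Y := a ^ (2 * L) * X ^ 2 * (Real.sqrt 2 / (L : ℝ)) ^ (2 * L - 1) with hY
    have hY0 : 0 ≤ Y := by positivity
    have h3 : W * r ≤ Y * 2 := by
      calc W * r ≤ Y * Real.sqrt 2 := by
            rw [← e2]
            gcongr
        _ ≤ Y * 2 := by
            gcongr
            linarith
    calc W * r / 2 * Real.sqrt A * B / q ≤ Y * Real.sqrt A * B / q := by
          gcongr
          linarith
      _ = _ := by rw [hY]; ring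
  refine hLHS.trans (le_trans ?_ hRHS)
  rw [show W * r / 2 * Real.sqrt A * B / q =
    W * Real.sqrt A * Real.sqrt B / q * ((r * Real.sqrt B) / 2) by rw [hBs]; simp; ring]
  calc 80 * s * W * Real.sqrt A * Real.sqrt B / q
      = W * Real.sqrt A * Real.sqrt B / q * (80 * s) := by ring
    _ ≤ _ := by
        gcongr
        linarith

end NetArch

theorem mainTheorem3 (K γ : ℝ) (hK : 0 < K) (hγ : 0 < γ) :
    (∀ (L : ℕ) (p : NetArch L) (m : ℕ), 0 < m →
      (∀ l, 1 ≤ l → l ≤ L → m ≤ p.width l) → p.MA ≤ 2 / (m : ℝ)) ∧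
    ∃ C : ℝ, 0 < C ∧
      ∀ (r : ℝ), 0 < r →
      ∃ n₀ : ℕ, ∀ (n : ℕ), n₀ ≤ n →
      ∀ (L : ℕ), 1 ≤ L → ∀ (a : ℝ), 0 ≤ a →
      ∀ (p : NetArch L) (f : p.Activations), p.IsAdmissible f a →
      ∀ (x : Fin n → p.Input), p.size a x = 0 ∨ r ≤ p.size a x →
      ∀ (g : p.Input → ℝ)
        (Ω : Type*) [MeasurableSpace Ω] (μ : Measure Ω) [IsProbabilityMeasure μ]
        (u : Fin n → Ω → ℝ), IsSubGaussianNoise μ u K γ →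
      p.MA < 1 → ∀ (ν : ℝ), 1 / (1 - p.MA) ≤ ν →
      ∀ (lam : ℝ),
        C * a ^ (2 * L) * p.inputNorm x ^ 2 *
            ((Real.sqrt 2 / (L : ℝ)) ^ (2 * L - 1) *
              Real.sqrt (Real.log (2 * (p.numParams : ℝ)))) *
            (Real.log (2 * (n : ℝ)) / Real.sqrt (n : ℝ)) ≤ lam →
      ∃ E : Set Ω, MeasurableSet E ∧ 1 - 1 / (n : ℝ) ≤ μ.real E ∧
        ∀ ω ∈ E, ∀ (κ : ℝ) (Θ : p.Params),
          p.IsEstimator f x (fun i => g (x i) + u i ω) lam ν κ Θ →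
          p.predErr f x g κ Θ ^ 2 ≤
            ⨅ q : {q : ℝ × p.Params // 0 ≤ q.1 ∧ q.2 ∈ p.unitBall ν},
              (p.predErr f x g q.1.1 q.1.2 ^ 2 + 2 * lam * q.1.1) := by
  refine ⟨fun L p m hm h => p.MA_le hm h, 1, one_pos, fun r hr => ?_⟩
  set s := Real.sqrt (K ^ 2 / 2 + 2 * γ ^ 2) with hs
  -- Chosen so that `160 s ≤ r √(log (2n))` from this sample size on.
  refine ⟨⌈Real.exp ((160 * s / r) ^ 2)⌉₊, ?_⟩
  intro n hn L hL a ha p f hf x hx g Ω _ μ _ u hu hMA ν hν lam hlam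
  have hexp : Real.exp ((160 * s / r) ^ 2) ≤ n := Nat.ceil_le.1 hn
  have hn1 : (1 : ℝ) ≤ n := (Real.one_le_exp (sq_nonneg _)).trans hexp
  have hn0 : 0 < n := by exact_mod_cast one_pos.trans_le hn1
  have hP : (1 : ℝ) ≤ p.numParams := by exact_mod_cast p.numParams_pos
  have hnr : 160 * s ≤ r * Real.sqrt (Real.log (2 * n)) := by
    have h1 : 160 * s / r ≤ Real.sqrt (Real.log (2 * n)) := by
      apply Real.le_sqrt_of_sq_le
      rw [Real.le_log_iff_exp_le (by positivity)]
      linarith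
    rw [div_le_iff₀ hr] at h1
    linarith
  rw [one_mul] at hlam
  rcases hx with hx | hx
  -- Zero size means `a = 0` or all inputs vanish. Either way every normalized network is zero on
  -- the data, and the whole probability space serves as the event.
  · have hzero : ∀ i, a ^ L * ‖x i‖ = 0 := by
      intro i
      have hLpos : (0 : ℝ) < L := by exact_mod_cast hL
      have hne1 : Real.sqrt (L : ℝ) ≠ 0 := (Real.sqrt_pos.2 hLpos).ne'
      have hne2 : (2 / (L : ℝ)) ^ L ≠ 0 := by positivity
      simp only [NetArch.size, mul_eq_zero, hne1, hne2, or_false] at hx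
      rcases hx with h | h
      · rw [h, zero_mul]
      · have h2 := p.inputNorm_sq x
        rw [h, zero_pow two_ne_zero, eq_comm, div_eq_zero_iff,
          or_iff_left (by positivity : (n : ℝ) ≠ 0)] at h2
        have h3 := (Finset.sum_eq_zero_iff_of_nonneg fun i _ => sq_nonneg ‖x i‖).1 h2 i
          (Finset.mem_univ i)
        rw [pow_eq_zero_iff two_ne_zero] at h3
        rw [h3, mul_zero]
    have hlam0 : 0 ≤ lam := by
      refine le_trans ?_ hlam
      have := Real.log_nonneg (by linarith : (1 : ℝ) ≤ 2 * n)
      positivity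
    refine ⟨Set.univ, MeasurableSet.univ, ?_, fun ω _ κ Θ hest =>
      p.predErr_sq_le_iInf (w := fun i => u i ω) (fun Θ' hΘ' => ?_) hest⟩
    · rw [probReal_univ]
      have : (0 : ℝ) ≤ 1 / n := by positivity
      linarith
    · refine (p.abs_noise_le_of_normalized hf (D := 0) hMA hν (fun Θ hΘ => ?_) hΘ').trans ?_
      · refine le_of_eq (abs_eq_zero.2 (Finset.sum_eq_zero fun i _ => ?_))
        have := p.abs_net_le ha hf hΘ (x i)
        rw [hzero i] at this
        rw [abs_nonpos_iff.1 this, mul_zero]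
      · simpa using hlam0
  · have hsz : 0 < p.size a x := hr.trans_le hx
    have hapos : 0 < a := by
      rcases ha.eq_or_lt with h | h
      · rw [NetArch.size, ← h, zero_pow (by omega)] at hsz
        simp at hsz
      · exact h
    have hXpos : 0 < p.inputNorm x := by
      rcases (p.inputNorm_nonneg x).eq_or_lt with h | h
      · rw [NetArch.size, ← h, mul_zero] at hsz
        exact absurd hsz (lt_irrefl _)
      · exact h
    obtain ⟨E, hE, hμE, hEle⟩ := p.exists_event_abs_noise_le hn0 hK hu hapos hf hXpos
    refine ⟨E, hE, hμE, fun ω hω κ Θ hest =>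
      p.predErr_sq_le_iInf (w := fun i => u i ω) (fun Θ' hΘ' => ?_) hest⟩
    refine (p.abs_noise_le_of_normalized hf hMA hν (hEle ω hω) hΘ').trans (le_trans ?_ hlam)
    exact NetArch.penalty_level_bound hn0 hL ha (Real.sqrt_nonneg _) hXpos.le hP hx hnr
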